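/- **Setting.** For each sample size $n$ let $X_n$ be a fixed $n\times p_n$ matrix, $\beta_n^*\in\mathbb{R}^{p_n}$, $\xi_n^*=\{j:\beta^*_{j,n}\neq 0\}$ and $s_n=|\xi_n^*|$. The data are $y_n=X_n\beta_n^*+\varepsilon_n$ with $\varepsilon_n\sim N(0,I_n)$. Let $\Phi_n$ be an $m_n\times n$ random matrix, independent of $\varepsilon_n$, with independent $N(0,1/n)$ entries, and let $\tilde y_n=\Phi_ny_n$, $\tilde X_n=\Phi_nX_n$. Given $\Phi_n$, $E_{\beta_n^*}$ denotes expectation under the true model $\tilde y_n\sim N(\tilde X_n\beta_n^*,\Phi_n\Phi_n')$. The working model is $\tilde y_n=\tilde X_n\beta+\epsilon$, $\epsilon\sim N(0,I_{m_n})$, with likelihood $f(\tilde y_n\mid\beta)$. The prior is $\pi_n(\beta)=\prod_{j=1}^{p_n}h_{\mu_n}(\beta_j)$, where $h_{\mu}(x)=\mu^{-1}h(x/\mu)$ with $\mu_n>0$ (for all large $n$), and $\Pi_n(C)=\int_C f(\tilde y_n|\beta)\pi_n(\beta)\,d\beta\big/\int f(\tilde y_n|\beta)\pi_n(\beta)\,d\beta$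 is the sketched posterior. Put $a_n=\sqrt{s_n\log(p_n)/m_n}/p_n$. **Theorem.** Assume that $p_n\to\infty$ and $m_n\to\infty$ as $n\to\infty$ and that: 1. $|x_{i,j}|\le 1$ for all entries of $X_n$, for all large $n$; 2. for some constant $C'>0$, $\|\Phi_n\Phi_n'-I_{m_n}\|_2\le C'\sqrt{m_n/n}$ with probability tending to one; 3. $s_n\log(p_n)=o(m_n)$ and $m_n=o(n)$; 4. there are $\eta>0$ and integers $\bar s_n$ with $s_n=o(\bar s_n)$ such that, for all large $n$, all eigenvalues of $X_{n,\xi}'X_{n,\xi}/n$ are at least $\eta$ for every $\xi\supseteq\xi_n^*$ with $|\xi|\le\bar s_n$, where $X_{n,\xi}$ consists of the columns of $X_n$ indexed by $\xi$; 5. for a nondecreasing sequence $M_n$ with $\log(M_n)=O(\log p_n)$, $\max_{j\in\xi_n^*}|\beta^*_{j,n}|<M_n/2$ for all large $n$; 6. $h$ is a probability density on $\mathbb{R}$ with polynomial tails: for some $r>1$ and constants $c_1,c_2>0$, $c_1|x|^{-r}\le h(x)\le c_2|x|^{-r}$ for all large $|x|$; 7. for some $u'>0$, $\mu_n\le a_np_n^{-(u'+1)/(r-1)}$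 for all large $n$, and $\log(\mu_n)=O(\log p_n)$. Then there are a constant $E>0$ and integers $\tilde s_n=O(s_n)$ such that, with $\theta_n=E\sqrt{s_n\log(p_n)/m_n}$, one has $\theta_n\to0$ and $$E_{\Phi_n}\,E_{\beta_n^*}\,\Pi_n(\mathcal{C}_n)\to 0,\qquad \mathcal{C}_n=\{\beta:\|\beta-\beta_n^*\|_2>3\theta_n\}\cup\{\beta:\ |\beta_k|\ge a_n\text{ for at least }\tilde s_n\text{ indices }k\}$$ (equivalently, $E_{\beta_n^*}\Pi_n(\mathcal{C}_n)\to0$ in probability with respect to $\Phi_n$). Condition 6 holds, with $r=2$, for the horseshoe density $h(x)=\int_0^\infty \frac{1}{\sqrt{2\pi}\,\lambda}e^{-x^2/(2\lambda^2)}\frac{2}{\pi(1+\lambda^2)}\,d\lambda$ and, with $r=1+\alpha$, for the generalized double Pareto density $h(x)=\frac{1}{2\xi}\bigl(1+\frac{|x|}{\alpha\xi}\bigr)^{-(1+\alpha)}$ with any $\xi,\alpha>0$. -/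

import Mathlib

open Filter Topology MeasureTheory ProbabilityTheory Asymptotics
open scoped ENNReal NNReal Matrix

noncomputable section

namespace Sketch

/-! ### The prior -/

/-- `h` is a probability density on the real line, possibly with poles (so `[0, ∞]`-valued), with
polynomial tails of order `r`: `c₁ |x|⁻ʳ ≤ h x ≤ c₂ |x|⁻ʳ` for all large `|x|`. -/
structure IsPolyTailDensity (h : ℝ → ℝ≥0∞) (r : ℝ) : Prop where
  measurable : Measurable h
  lintegral_eq_one : ∫⁻ x, h x = 1
  tail : ∃ c₁ c₂ R : ℝ, 0 < c₁ ∧ 0 < c₂ ∧ ∀ x : ℝ, R ≤ |x| →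
    ENNReal.ofReal (c₁ * |x| ^ (-r)) ≤ h x ∧ h x ≤ ENNReal.ofReal (c₂ * |x| ^ (-r))

/-- The scale family `x ↦ h (x / μ) / μ` generated by the density `h`. -/
def scaledDensity (h : ℝ → ℝ≥0∞) (μ : ℝ) (x : ℝ) : ℝ≥0∞ :=
  ENNReal.ofReal μ⁻¹ * h (x / μ)

/-- The prior on `ℝᵖ`: independent coordinates, each with density `scaledDensity h μ`. -/
def prior (p : ℕ) (h : ℝ → ℝ≥0∞) (μ : ℝ) : Measure (Fin p → ℝ) :=
  Measure.pi fun _ => volume.withDensity (scaledDensity h μ)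

/-- The (unit scale) horseshoe density: the mixture of `N(0, l²)` over a half-Cauchy scale `l`. -/
def horseshoeDensity (x : ℝ) : ℝ≥0∞ :=
  ∫⁻ l in Set.Ioi (0 : ℝ),
    gaussianPDF 0 (l ^ 2).toNNReal x * ENNReal.ofReal (2 / (Real.pi * (1 + l ^ 2)))

/-- The generalized double Pareto density with scale `ξ` and shape `α`. -/
def gdpDensity (ξ α : ℝ) (x : ℝ) : ℝ≥0∞ :=
  ENNReal.ofReal (1 / (2 * ξ) * (1 + |x| / (α * ξ)) ^ (-(1 + α)))

/-! ### The sketched model and its posterior -/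

/-- The joint density at `y` of the working model `y = Z β + e`, `e ∼ N(0, I)`. -/
def likelihood {m p : ℕ} (Z : Matrix (Fin m) (Fin p) ℝ) (y : Fin m → ℝ) (β : Fin p → ℝ) : ℝ≥0∞ :=
  ∏ i, gaussianPDF ((Z *ᵥ β) i) 1 (y i)

/-- The posterior probability of `C`, for the prior `π` and the data `(y, Z)`. -/
def posterior {m p : ℕ} (π : Measure (Fin p → ℝ)) (Z : Matrix (Fin m) (Fin p) ℝ)
    (y : Fin m → ℝ) (C : Set (Fin p → ℝ)) : ℝ≥0∞ :=
  (∫⁻ β in C, likelihood Z y β ∂π) / ∫⁻ β, likelihood Z y β ∂π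

/-- The law of the Gaussian sketching matrix: `m × n` independent entries, each `N(0, 1/n)`. -/
def sketchLaw (m n : ℕ) : Measure (Fin m → Fin n → ℝ) :=
  Measure.pi fun _ => Measure.pi fun _ => gaussianReal 0 (1 / (n : ℝ≥0))

/-- The law of the noise in the full data: `N(0, Iₙ)`. -/
def noiseLaw (n : ℕ) : Measure (Fin n → ℝ) :=
  Measure.pi fun _ => gaussianReal 0 1

/-- For a given sketching matrix `Φ`, the expectation of the posterior probability of `C` computed
from the sketched data `(Φ y, Φ X)`, when `y = X βs + ε` with `ε ∼ N(0, Iₙ)`, so that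
`Φ y ∼ N(Φ X βs, Φ Φᵀ)`. -/
def expectedPosterior {m n p : ℕ} (π : Measure (Fin p → ℝ)) (X : Matrix (Fin n) (Fin p) ℝ)
    (βs : Fin p → ℝ) (C : Set (Fin p → ℝ)) (Φ : Matrix (Fin m) (Fin n) ℝ) : ℝ≥0∞ :=
  ∫⁻ ε, posterior π (Φ * X) (Φ *ᵥ (X *ᵥ βs + ε)) C ∂(noiseLaw n)

/-! ### Sparsity, rates and the exceptional set -/

/-- The indices of the nonzero entries. -/
def activeSet {p : ℕ} (β : Fin p → ℝ) : Finset (Fin p) :=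
  Finset.univ.filter fun j => β j ≠ 0

/-- The number of nonzero entries. -/
def sparsity {p : ℕ} (β : Fin p → ℝ) : ℕ := (activeSet β).card

/-- `√(s log p / m)`. -/
def rate (s p m : ℕ) : ℝ := Real.sqrt (s * Real.log p / m)

/-- The threshold `√(s log p / m) / p` above which a coefficient counts as nonzero. -/
def threshold (s p m : ℕ) : ℝ := rate s p m / p

/-- The vectors at Euclidean distance more than `3 θ` from `βs`, together with those that have at
least `k` coordinates of absolute value at least `a`. -/
def exceptionalSet {p : ℕ} (βs : Fin p → ℝ) (θ a : ℝ) (k : ℕ) : Set (Fin p → ℝ) :=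
  {β | 3 * θ < ‖WithLp.toLp 2 (β - βs)‖} ∪
    {β | k ≤ (Finset.univ.filter fun j => a ≤ |β j|).card}

/-- The spectral norm of a real square matrix. -/
def spectralNorm {m : ℕ} (A : Matrix (Fin m) (Fin m) ℝ) : ℝ :=
  ‖Matrix.toEuclideanCLM (n := Fin m) (𝕜 := ℝ) A‖

/-- The Gram matrix `X_ξᵀ X_ξ / n` of the columns of `X` with index in `ξ`. -/
def gram {n p : ℕ} (X : Matrix (Fin n) (Fin p) ℝ) (ξ : Finset (Fin p)) : Matrix ξ ξ ℝ :=
  (n : ℝ)⁻¹ • ((X.submatrix id (fun j : ξ => (j : Fin p)))ᵀ *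
    X.submatrix id (fun j : ξ => (j : Fin p)))

end Sketch

end

open Filter Topology MeasureTheory ProbabilityTheory Asymptotics
open scoped ENNReal NNReal Matrix

noncomputable section

namespace Sketch

/-! ### Gaussian integrals -/

/-! Write `L = log p`, `l = s L` and `R = rate s p m`, so that `m R² = l` and `p a = R`. After
cancelling a factor free of `β`, the posterior is a ratio of prior integrals of `exp (logRatio Z e
(β - βs))`, with `Z = Φ X` and noise `e = Φ ε`. Everything is measured on the scale `exp (l)`: the
denominator is at least `exp (-(B + 10) l)`, and the numerator over the exceptional set is beaten
down to a smaller exponential by choosing first `A` (with `s̃ = A s`) and then `E` large.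

Denominator. On the box of half-width `a` around the truth the coordinates differ by at most `p a =
R` in total, so the log-ratio is at least `-10 l` (`le_logRatio`); the polynomial tails and the
polynomial bounds on `M` and `1/μ` give the box prior mass `exp (-B l)` (`le_prior_box`,
`exists_prior_bounds`).

Numerator, many large coordinates. The working model has covariance `I` but `e` has covariance `Φ
Φᵀ`, so the likelihood ratio need not have mean at most one. Its power `t = 1/(1 + d)` does
(`lintegral_exp_logRatio_le`), where `d` bounds the spectral norm of `Φ Φᵀ - I`. The leftover power
`1 - t ≤ d` costs a small multiple of `L` times the number of large coordinates, and the prior pays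
for it: that number has a bounded exponential moment at rate `u log p`
(`lintegral_exp_numLarge_prior_le`).

Numerator, few large coordinates but far from the truth. The difference is, up to an `l¹` error `R`,
supported on at most `(A + 1) s` indices. There the noise is controlled simultaneously over all
supports (`noiseLaw_not_noiseControlled_le`) and the sketched design keeps a restricted eigenvalue
(`sketchLaw_restrictedEigenvalue_le`), so the quadratic term dominates pointwise (`logRatio_le`).

`expectedPosterior_le` combines these for a good sketch, and `lintegral_expectedPosterior_le` adds
the probability of a bad one. -/

instance (n : ℕ) : IsProbabilityMeasure (noiseLaw n) := by unfold noiseLaw; infer_instance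

instance (m n : ℕ) : IsProbabilityMeasure (sketchLaw m n) := by unfold sketchLaw; infer_instance

lemma lintegral_pi_prod {ι : Type*} [Fintype ι] {E : ι → Type*} [∀ i, MeasurableSpace (E i)]
    (μ : ∀ i, Measure (E i)) [∀ i, IsProbabilityMeasure (μ i)] (f : ∀ i, E i → ℝ≥0∞)
    (hf : ∀ i, Measurable (f i)) :
    ∫⁻ x, ∏ i, f i (x i) ∂(Measure.pi μ) = ∏ i, ∫⁻ y, f i y ∂(μ i) := by
  have h := lintegral_prod_eq_prod_lintegral_of_indepFun (μ := Measure.pi μ) Finset.univ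
    (fun i x => f i (x i)) (iIndepFun_pi fun i => (hf i).aemeasurable)
    (fun i => (hf i).comp (measurable_pi_apply i))
  rw [h]
  refine Finset.prod_congr rfl fun i _ => ?_
  exact (measurePreserving_eval μ i).lintegral_comp (hf i)

lemma lintegral_exp_mul_gaussianReal (v : ℝ≥0) (t : ℝ) :
    ∫⁻ x, ENNReal.ofReal (Real.exp (t * x)) ∂(gaussianReal 0 v) =
      ENNReal.ofReal (Real.exp (v * t ^ 2 / 2)) := by
  rw [← ofReal_integral_eq_lintegral_ofReal (integrable_exp_mul_gaussianReal t)
    (ae_of_all _ fun x => (Real.exp_pos _).le)]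
  have := congrFun (mgf_fun_id_gaussianReal (μ := 0) (v := v)) t
  simp only [mgf, zero_mul, zero_add] at this
  rw [this]

lemma lintegral_exp_dotProduct_noiseLaw {n : ℕ} (a : Fin n → ℝ) :
    ∫⁻ ε, ENNReal.ofReal (Real.exp (a ⬝ᵥ ε)) ∂(noiseLaw n) =
      ENNReal.ofReal (Real.exp ((a ⬝ᵥ a) / 2)) := by
  have h : ∀ ε : Fin n → ℝ, ENNReal.ofReal (Real.exp (a ⬝ᵥ ε)) =
      ∏ i, ENNReal.ofReal (Real.exp (a i * ε i)) := fun ε => by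
    rw [← ENNReal.ofReal_prod_of_nonneg fun i _ => (Real.exp_pos _).le, ← Real.exp_sum]; rfl
  simp_rw [h]
  rw [noiseLaw, lintegral_pi_prod _ (fun i x => ENNReal.ofReal (Real.exp (a i * x)))
    (fun i => by fun_prop)]
  simp_rw [lintegral_exp_mul_gaussianReal]
  rw [← ENNReal.ofReal_prod_of_nonneg fun i _ => (Real.exp_pos _).le, ← Real.exp_sum]
  congr 2
  rw [dotProduct, Finset.sum_div]
  exact Finset.sum_congr rfl fun i _ => by simp; ring

lemma lintegral_exp_sq_gaussianReal {c : ℝ} (hc : c < 1 / 2) :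
    ∫⁻ x, ENNReal.ofReal (Real.exp (c * x ^ 2)) ∂(gaussianReal 0 1) =
      ENNReal.ofReal (1 / Real.sqrt (1 - 2 * c)) := by
  rw [gaussianReal_of_var_ne_zero _ one_ne_zero,
    lintegral_withDensity_eq_lintegral_mul _ (measurable_gaussianPDF _ _) (by fun_prop)]
  have h : ∀ x : ℝ, (gaussianPDF 0 1 * fun x => ENNReal.ofReal (Real.exp (c * x ^ 2))) x =
      ENNReal.ofReal ((Real.sqrt (2 * Real.pi))⁻¹ * Real.exp (-(1 / 2 - c) * x ^ 2)) := by
    intro x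
    rw [Pi.mul_apply, gaussianPDF, gaussianPDFReal,
      ← ENNReal.ofReal_mul (by positivity)]
    congr 1
    simp only [NNReal.coe_one, mul_one, sub_zero]
    rw [mul_assoc, ← Real.exp_add]
    congr 2
    ring
  simp_rw [h]
  have hb : 0 < 1 / 2 - c := by linarith
  rw [← ofReal_integral_eq_lintegral_ofReal ((integrable_exp_neg_mul_sq hb).const_mul _)
    (ae_of_all _ fun x => by positivity), integral_const_mul, integral_gaussian]
  congr 1
  rw [← Real.sqrt_inv, ← Real.sqrt_mul (by positivity), one_div (Real.sqrt _), ← Real.sqrt_inv]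
  congr 1
  have : (1 - 2 * c) = 2 * (1 / 2 - c) := by ring
  rw [this]
  field_simp

/-- A Gaussian quadratic form has a controlled exponential moment (by decoupling). -/
lemma lintegral_exp_sum_sq_le {n d : ℕ} (a : Fin d → Fin n → ℝ)
    (ha : ∀ g : Fin d → ℝ, (∑ i, g i • a i) ⬝ᵥ (∑ i, g i • a i) ≤ 2 * (g ⬝ᵥ g)) :
    ∫⁻ ε, ENNReal.ofReal (Real.exp ((∑ i, (a i ⬝ᵥ ε) ^ 2) / 8)) ∂(noiseLaw n) ≤
      ENNReal.ofReal (Real.sqrt 2 ^ d) := by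
  -- Linearize the square: `exp (|x|² / 8)` is the mean of `exp (x ⬝ g / 2)` over an independent
  -- standard Gaussian `g`. After swapping, the `ε`-integral is explicit and at most `exp (|g|² /
  -- 4)`.
  have h1 : ∀ ε : Fin n → ℝ, ENNReal.ofReal (Real.exp ((∑ i, (a i ⬝ᵥ ε) ^ 2) / 8)) =
      ∫⁻ g, ENNReal.ofReal (Real.exp ((fun i => (1 / 2) * (a i ⬝ᵥ ε)) ⬝ᵥ g)) ∂(noiseLaw d) := by
    intro ε
    rw [lintegral_exp_dotProduct_noiseLaw]
    congr 2
    rw [dotProduct, Finset.sum_div, Finset.sum_div]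
    exact Finset.sum_congr rfl fun i _ => by ring
  have h2 : ∀ (ε : Fin n → ℝ) (g : Fin d → ℝ), (fun i => (1 / 2) * (a i ⬝ᵥ ε)) ⬝ᵥ g =
      ((1 / 2 : ℝ) • ∑ i, g i • a i) ⬝ᵥ ε := by
    intro ε g
    rw [smul_dotProduct, sum_dotProduct, dotProduct, smul_eq_mul, Finset.mul_sum]
    exact Finset.sum_congr rfl fun i _ => by rw [smul_dotProduct, smul_eq_mul]; ring
  simp_rw [h1, h2]
  rw [lintegral_lintegral_swap (by
    refine Measurable.aemeasurable ?_
    refine ENNReal.measurable_ofReal.comp (Continuous.measurable ?_)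
    simp only [dotProduct, Pi.smul_apply, Finset.sum_apply]
    fun_prop)]
  calc ∫⁻ g, ∫⁻ ε, ENNReal.ofReal (Real.exp (((1 / 2 : ℝ) • ∑ i, g i • a i) ⬝ᵥ ε))
        ∂(noiseLaw n) ∂(noiseLaw d)
      ≤ ∫⁻ g : Fin d → ℝ, ∏ i, ENNReal.ofReal (Real.exp ((1 / 4) * g i ^ 2)) ∂(noiseLaw d) := by
        refine lintegral_mono fun g => ?_
        rw [lintegral_exp_dotProduct_noiseLaw,
          ← ENNReal.ofReal_prod_of_nonneg fun i _ => (Real.exp_pos _).le, ← Real.exp_sum]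
        refine ENNReal.ofReal_le_ofReal (Real.exp_le_exp.2 ?_)
        rw [smul_dotProduct, dotProduct_smul, ← Finset.mul_sum]
        have := ha g
        have h3 : g ⬝ᵥ g = ∑ i, g i ^ 2 := by
          simp [dotProduct, sq]
        rw [h3] at this
        simp only [smul_eq_mul]
        linarith
    _ = ENNReal.ofReal (Real.sqrt 2 ^ d) := by
        rw [noiseLaw, lintegral_pi_prod _ (fun i x => ENNReal.ofReal (Real.exp (1 / 4 * x ^ 2)))
          (fun i => by fun_prop)]
        simp_rw [lintegral_exp_sq_gaussianReal (c := 1 / 4) (by norm_num)]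
        rw [Finset.prod_const, Finset.card_univ, Fintype.card_fin,
          ← ENNReal.ofReal_pow (by positivity)]
        congr 2
        rw [one_div, ← Real.sqrt_inv]
        norm_num

/-- A linear form of a row of the sketching matrix is Gaussian. -/
lemma map_dotProduct_pi_gaussianReal {n : ℕ} (v : ℝ≥0) (z : Fin n → ℝ) :
    (Measure.pi fun _ : Fin n => gaussianReal 0 v).map (fun φ => φ ⬝ᵥ z) =
      gaussianReal 0 ((z ⬝ᵥ z).toNNReal * v) := by
  have hm : Measurable fun φ : Fin n → ℝ => φ ⬝ᵥ z := by
    simp only [dotProduct]; fun_prop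
  refine Measure.ext_of_charFun (funext fun t => ?_)
  rw [charFun_apply_real, integral_map hm.aemeasurable
    (Measurable.aestronglyMeasurable (by fun_prop))]
  have h : ∀ φ : Fin n → ℝ, Complex.exp (t * ((φ ⬝ᵥ z : ℝ) : ℂ) * Complex.I) =
      ∏ i, Complex.exp (((t * z i : ℝ) : ℂ) * ((φ i : ℝ) : ℂ) * Complex.I) := by
    intro φ
    rw [← Complex.exp_sum, dotProduct, Complex.ofReal_sum, Finset.mul_sum, Finset.sum_mul]
    congr 1
    exact Finset.sum_congr rfl fun i _ => by push_cast; ring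
  simp_rw [h]
  rw [integral_fintype_prod_eq_prod
    (f := fun i (x : ℝ) => Complex.exp (((t * z i : ℝ) : ℂ) * (x : ℂ) * Complex.I))]
  simp_rw [← charFun_apply_real, charFun_gaussianReal]
  rw [← Complex.exp_sum]
  congr 1
  have hz : 0 ≤ z ⬝ᵥ z := by
    rw [dotProduct]; exact Finset.sum_nonneg fun i _ => mul_self_nonneg _
  have : (((z ⬝ᵥ z).toNNReal * v : ℝ≥0) : ℂ) = ((∑ i, z i * z i : ℝ) : ℂ) * (v : ℂ) := by
    rw [NNReal.coe_mul, Real.coe_toNNReal _ hz, dotProduct]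
    push_cast
    rfl
  rw [this]
  push_cast
  rw [Finset.sum_mul, Finset.sum_mul, Finset.sum_div, mul_zero, zero_mul, zero_sub,
    ← Finset.sum_neg_distrib]
  exact Finset.sum_congr rfl fun i _ => by ring

lemma lintegral_exp_sq_gaussianReal_var (v : ℝ≥0) {c : ℝ} (hc : c * v < 1 / 2) :
    ∫⁻ x, ENNReal.ofReal (Real.exp (c * x ^ 2)) ∂(gaussianReal 0 v) =
      ENNReal.ofReal (1 / Real.sqrt (1 - 2 * (c * v))) := by
  have h : gaussianReal 0 v = (gaussianReal 0 1).map (fun x => Real.sqrt v * x) := by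
    rw [gaussianReal_map_const_mul]
    congr 1
    · simp
    · ext; simp
  rw [h, lintegral_map (by fun_prop) (by fun_prop), ← lintegral_exp_sq_gaussianReal hc]
  refine lintegral_congr fun x => ?_
  rw [mul_pow, Real.sq_sqrt v.coe_nonneg, mul_assoc]

/-- The exponential moments of `‖Φ z‖²` under the law of the sketching matrix. -/
lemma lintegral_exp_mulVec_sketchLaw {m n : ℕ} (z : Fin n → ℝ) {c : ℝ}
    (hc : c * ((z ⬝ᵥ z) / n) < 1 / 2) :
    ∫⁻ Φ, ENNReal.ofReal (Real.exp (c * ((Matrix.of Φ *ᵥ z) ⬝ᵥ (Matrix.of Φ *ᵥ z))))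
        ∂(sketchLaw m n) =
      ENNReal.ofReal ((1 / Real.sqrt (1 - 2 * (c * ((z ⬝ᵥ z) / n)))) ^ m) := by
  have h : ∀ Φ : Fin m → Fin n → ℝ,
      ENNReal.ofReal (Real.exp (c * ((Matrix.of Φ *ᵥ z) ⬝ᵥ (Matrix.of Φ *ᵥ z)))) =
      ∏ i, ENNReal.ofReal (Real.exp (c * (Φ i ⬝ᵥ z) ^ 2)) := fun Φ => by
    rw [← ENNReal.ofReal_prod_of_nonneg fun i _ => (Real.exp_pos _).le, ← Real.exp_sum,
      dotProduct, Finset.mul_sum]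
    congr 2
    exact Finset.sum_congr rfl fun i _ => by rw [sq]; rfl
  have hm : Measurable fun φ : Fin n → ℝ => φ ⬝ᵥ z := by
    simp only [dotProduct]; fun_prop
  have hz : 0 ≤ z ⬝ᵥ z := by
    rw [dotProduct]; exact Finset.sum_nonneg fun i _ => mul_self_nonneg _
  simp_rw [h]
  rw [sketchLaw, lintegral_pi_prod _ (fun _ φ => ENNReal.ofReal (Real.exp (c * (φ ⬝ᵥ z) ^ 2)))
    (fun i => by fun_prop)]
  rw [Finset.prod_const, Finset.card_univ, Fintype.card_fin, ENNReal.ofReal_pow (by positivity)]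
  congr 1
  have hv : (((z ⬝ᵥ z).toNNReal * (1 / (n : ℝ≥0)) : ℝ≥0) : ℝ) = (z ⬝ᵥ z) / n := by
    rw [NNReal.coe_mul, Real.coe_toNNReal _ hz]
    push_cast
    ring
  rw [← hv] at hc ⊢
  rw [← lintegral_exp_sq_gaussianReal_var _ hc, ← map_dotProduct_pi_gaussianReal,
    lintegral_map (by fun_prop) hm]

/-! ### Euclidean geometry -/

/-- The Euclidean norm of a vector given by its coordinates. -/
def l2norm {ι : Type*} [Fintype ι] (x : ι → ℝ) : ℝ := ‖WithLp.toLp 2 x‖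

lemma mulVec_eq_sum_smul_col {ι κ : Type*} [Fintype κ] (Z : Matrix ι κ ℝ) (v : κ → ℝ) :
    Z *ᵥ v = ∑ j, v j • fun i => Z i j := by
  ext i
  simp [Matrix.mulVec, dotProduct, Finset.sum_apply, mul_comm]

section l2norm

variable {ι κ : Type*} [Fintype ι] [Fintype κ]

lemma l2norm_nonneg (x : ι → ℝ) : 0 ≤ l2norm x := norm_nonneg _

lemma inner_toLp (x y : ι → ℝ) : inner ℝ (WithLp.toLp 2 x) (WithLp.toLp 2 y) = x ⬝ᵥ y := by
  rw [EuclideanSpace.inner_toLp_toLp, dotProduct_comm]; simp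

lemma l2norm_sq (x : ι → ℝ) : l2norm x ^ 2 = x ⬝ᵥ x := by
  rw [l2norm, ← real_inner_self_eq_norm_sq, inner_toLp]

lemma dotProduct_self_nonneg_real (x : ι → ℝ) : 0 ≤ x ⬝ᵥ x := by
  rw [← l2norm_sq]; positivity

lemma abs_dotProduct_le (x y : ι → ℝ) : |x ⬝ᵥ y| ≤ l2norm x * l2norm y := by
  rw [← inner_toLp]; exact abs_real_inner_le_norm _ _

lemma l2norm_add_le (x y : ι → ℝ) : l2norm (x + y) ≤ l2norm x + l2norm y := norm_add_le _ _

lemma l2norm_smul (c : ℝ) (x : ι → ℝ) : l2norm (c • x) = |c| * l2norm x := by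
  rw [l2norm, WithLp.toLp_smul, norm_smul]; rfl

lemma l2norm_sub_comm (x y : ι → ℝ) : l2norm (x - y) = l2norm (y - x) := norm_sub_rev _ _

lemma l2norm_sum_le {α : Type*} (s : Finset α) (f : α → ι → ℝ) :
    l2norm (∑ a ∈ s, f a) ≤ ∑ a ∈ s, l2norm (f a) := by
  unfold l2norm
  rw [WithLp.toLp_sum]
  exact norm_sum_le _ _

lemma l2norm_le_sum_abs (x : ι → ℝ) : l2norm x ≤ ∑ j, |x j| := by
  classical
  have h : x = ∑ j, x j • (Pi.single j (1 : ℝ) : ι → ℝ) := by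
    ext i; simp [Finset.sum_apply, Pi.single_apply]
  calc l2norm x = l2norm (∑ j, x j • (Pi.single j (1 : ℝ) : ι → ℝ)) := by rw [← h]
    _ ≤ ∑ j, l2norm (x j • (Pi.single j (1 : ℝ) : ι → ℝ)) := l2norm_sum_le _ _
    _ = ∑ j, |x j| := by
      refine Finset.sum_congr rfl fun j _ => ?_
      rw [l2norm_smul]
      simp [l2norm]

lemma l2norm_mulVec_le {Z : Matrix ι κ ℝ} {c : ℝ} (hZ : ∀ j, l2norm (fun i => Z i j) ≤ c)
    (v : κ → ℝ) : l2norm (Z *ᵥ v) ≤ c * ∑ j, |v j| := by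
  rw [mulVec_eq_sum_smul_col, Finset.mul_sum]
  refine (l2norm_sum_le _ _).trans (Finset.sum_le_sum fun j _ => ?_)
  rw [l2norm_smul, mul_comm]
  exact mul_le_mul_of_nonneg_right (hZ j) (abs_nonneg _)

end l2norm

/-! ### The sketched noise -/

/-- The noise `e` is controlled along the span of every set of columns of `Z`. -/
def NoiseControlled {m p : ℕ} (Z : Matrix (Fin m) (Fin p) ℝ) (L : ℝ) (e : Fin m → ℝ) : Prop :=
  ∀ (S : Finset (Fin p)) (v : Fin p → ℝ), (∀ j ∉ S, v j = 0) →
    e ⬝ᵥ (Z *ᵥ v) ≤ 4 * Real.sqrt (S.card * L) * l2norm (Z *ᵥ v)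

/-- Markov's inequality for exponential moments. -/
lemma measure_le_of_exp_moment {Ω : Type*} [MeasurableSpace Ω] (P : Measure Ω) {f : Ω → ℝ}
    (hf : Measurable f) {A : Set Ω} {t B : ℝ} (hA : ∀ ω ∈ A, t ≤ f ω)
    (hB : ∫⁻ ω, ENNReal.ofReal (Real.exp (f ω)) ∂P ≤ ENNReal.ofReal B) :
    P A ≤ ENNReal.ofReal (B * Real.exp (-t)) := by
  have h := mul_meas_ge_le_lintegral (μ := P) (f := fun ω => ENNReal.ofReal (Real.exp (f ω)))
    (by fun_prop) (ENNReal.ofReal (Real.exp t))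
  have h1 : P A ≤ P {ω | ENNReal.ofReal (Real.exp t) ≤ ENNReal.ofReal (Real.exp (f ω))} :=
    measure_mono fun ω hω => ENNReal.ofReal_le_ofReal (Real.exp_le_exp.2 (hA ω hω))
  have h2 : ENNReal.ofReal (Real.exp (-t)) * ENNReal.ofReal (Real.exp t) = 1 := by
    rw [← ENNReal.ofReal_mul (Real.exp_pos _).le, ← Real.exp_add]; simp
  calc P A = ENNReal.ofReal (Real.exp (-t)) * (ENNReal.ofReal (Real.exp t) * P A) := by
        rw [← mul_assoc, h2, one_mul]
    _ ≤ ENNReal.ofReal (Real.exp (-t)) * ENNReal.ofReal B := by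
        gcongr
        exact (mul_le_mul_right h1 _).trans (h.trans hB)
    _ = ENNReal.ofReal (B * Real.exp (-t)) := by
        rw [mul_comm, ENNReal.ofReal_mul' (Real.exp_pos _).le]

/-- Uniformity in `v` comes from projecting `Φ ε` on the span of the columns in `S`, of dimension at
most `|S|`: by Cauchy–Schwarz a violation forces the squared projection above `16 |S| L`, whatever
`v` is. In an orthonormal basis the projection is a Gaussian quadratic form, to which the
exponential Markov inequality applies. -/
lemma noiseLaw_span_le {m n p : ℕ} (Φ : Matrix (Fin m) (Fin n) ℝ)
    (hΦ : ∀ x, (Φᵀ *ᵥ x) ⬝ᵥ (Φᵀ *ᵥ x) ≤ 2 * (x ⬝ᵥ x)) (Z : Matrix (Fin m) (Fin p) ℝ)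
    (S : Finset (Fin p)) {L : ℝ} (hL : 0 ≤ L) :
    noiseLaw n {ε | ∃ v : Fin p → ℝ, (∀ j ∉ S, v j = 0) ∧
        4 * Real.sqrt (S.card * L) * l2norm (Z *ᵥ v) < (Φ *ᵥ ε) ⬝ᵥ (Z *ᵥ v)} ≤
      ENNReal.ofReal ((Real.sqrt 2 * Real.exp (-(2 * L))) ^ S.card) := by
  classical
  let col : Fin p → EuclideanSpace ℝ (Fin m) := fun j => WithLp.toLp 2 fun i => Z i j
  let W : Submodule ℝ (EuclideanSpace ℝ (Fin m)) := Submodule.span ℝ (S.image col : Set _)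
  have hd : Module.finrank ℝ W ≤ S.card :=
    (finrank_span_finset_le_card _).trans Finset.card_image_le
  let b := stdOrthonormalBasis ℝ W
  let bv : Fin (Module.finrank ℝ W) → Fin m → ℝ := fun i => WithLp.ofLp (b i : EuclideanSpace ℝ (Fin m))
  let a : Fin (Module.finrank ℝ W) → Fin n → ℝ := fun i => Φᵀ *ᵥ bv i
  have ha : ∀ g : Fin (Module.finrank ℝ W) → ℝ,
      (∑ i, g i • a i) ⬝ᵥ (∑ i, g i • a i) ≤ 2 * (g ⬝ᵥ g) := by
    intro g
    have h1 : ∑ i, g i • a i = Φᵀ *ᵥ (∑ i, g i • bv i) := by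
      rw [Matrix.mulVec_sum]
      exact Finset.sum_congr rfl fun i _ => by rw [Matrix.mulVec_smul]
    rw [h1]
    refine (hΦ _).trans (le_of_eq ?_)
    congr 1
    rw [← l2norm_sq, l2norm]
    have h2 : (WithLp.toLp 2 (∑ i, g i • bv i) : EuclideanSpace ℝ (Fin m)) =
        ((∑ i, g i • b i : W) : EuclideanSpace ℝ (Fin m)) := by
      ext k
      simp [bv, Finset.sum_apply]
    rw [h2, ← Submodule.coe_norm, ← real_inner_self_eq_norm_sq]
    rw [b.orthonormal.inner_sum]
    simp [dotProduct]
  have hmom := lintegral_exp_sum_sq_le a ha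
  refine (measure_le_of_exp_moment (noiseLaw n) (t := 2 * S.card * L)
    (f := fun ε => (∑ i, (a i ⬝ᵥ ε) ^ 2) / 8) ?_ ?_ hmom).trans ?_
  · simp only [dotProduct]; fun_prop
  · rintro ε ⟨v, hv, hlt⟩
    have hmem : (WithLp.toLp 2 (Z *ᵥ v) : EuclideanSpace ℝ (Fin m)) ∈ W := by
      have : (WithLp.toLp 2 (Z *ᵥ v) : EuclideanSpace ℝ (Fin m)) = ∑ j ∈ S, v j • col j := by
        rw [mulVec_eq_sum_smul_col, WithLp.toLp_sum]
        rw [← Finset.sum_subset (Finset.subset_univ S)]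
        · rfl
        · intro j _ hj; simp [hv j hj]
      rw [this]
      exact Submodule.sum_mem _ fun j hj => Submodule.smul_mem _ _
        (Submodule.subset_span (by simpa using ⟨j, hj, rfl⟩))
    let w : W := ⟨_, hmem⟩
    have hw : Z *ᵥ v = ∑ i, (b.repr w i) • bv i := by
      have h3 : (w : EuclideanSpace ℝ (Fin m)) = ((∑ i, b.repr w i • b i : W) : EuclideanSpace ℝ (Fin m)) := by
        rw [b.sum_repr]
      have h4 := congrArg WithLp.ofLp h3
      change Z *ᵥ v = _ at h4
      rw [h4]
      ext k
      simp [bv, Finset.sum_apply]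
    have hnorm : l2norm (Z *ᵥ v) = l2norm (fun i => b.repr w i) := by
      have : ‖w‖ = ‖b.repr w‖ := (b.repr.norm_map w).symm
      exact this
    have hin : (Φ *ᵥ ε) ⬝ᵥ (Z *ᵥ v) = (fun i => a i ⬝ᵥ ε) ⬝ᵥ (fun i => b.repr w i) := by
      rw [hw, dotProduct_sum]
      simp only [dotProduct_smul, smul_eq_mul]
      rw [dotProduct]
      refine Finset.sum_congr rfl fun i _ => ?_
      rw [mul_comm]
      congr 1
      rw [dotProduct_comm, Matrix.dotProduct_mulVec, ← Matrix.mulVec_transpose]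
    rw [hin] at hlt
    have hcs := (le_abs_self _).trans
      (abs_dotProduct_le (fun i => a i ⬝ᵥ ε) (fun i => b.repr w i))
    rw [hnorm] at hlt
    have hpos := l2norm_nonneg (fun i => b.repr w i)
    have h5 : 4 * Real.sqrt (S.card * L) < l2norm fun i => a i ⬝ᵥ ε :=
      lt_of_mul_lt_mul_right (hlt.trans_le hcs) hpos
    have h6 : l2norm (fun i => a i ⬝ᵥ ε) ^ 2 = ∑ i, (a i ⬝ᵥ ε) ^ 2 := by
      rw [l2norm_sq]; simp [dotProduct, sq]
    have h7 : (4 * Real.sqrt (S.card * L)) ^ 2 ≤ l2norm (fun i => a i ⬝ᵥ ε) ^ 2 :=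
      pow_le_pow_left₀ (mul_nonneg (by norm_num) (Real.sqrt_nonneg _)) h5.le 2
    rw [mul_pow, Real.sq_sqrt (mul_nonneg (Nat.cast_nonneg _) hL), h6] at h7
    change _ ≤ (∑ i, (a i ⬝ᵥ ε) ^ 2) / 8
    linarith
  · refine ENNReal.ofReal_le_ofReal ?_
    rw [mul_pow, ← Real.exp_nat_mul]
    have h8 : (1 : ℝ) ≤ Real.sqrt 2 := by rw [Real.one_le_sqrt]; norm_num
    refine mul_le_mul (pow_le_pow_right₀ h8 hd) (Real.exp_le_exp.2 (le_of_eq (by ring)))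
      (Real.exp_pos _).le (by positivity)

lemma sum_finset_pow_card (p : ℕ) (x : ℝ) : ∑ S : Finset (Fin p), x ^ S.card = (1 + x) ^ p := by
  have := Fintype.sum_pow_mul_eq_add_pow (Fin p) x (1 : ℝ)
  simpa [add_comm] using this

/-- A union bound over all supports, summed by the binomial theorem. The `-1` is the empty support,
which never fails since it only allows `v = 0`; without removing it the bound would be useless. -/
lemma noiseLaw_not_noiseControlled_le {m n p : ℕ} (Φ : Matrix (Fin m) (Fin n) ℝ)
    (hΦ : ∀ x, (Φᵀ *ᵥ x) ⬝ᵥ (Φᵀ *ᵥ x) ≤ 2 * (x ⬝ᵥ x)) (Z : Matrix (Fin m) (Fin p) ℝ)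
    {L : ℝ} (hL : 0 ≤ L) :
    noiseLaw n {ε | ¬ NoiseControlled Z L (Φ *ᵥ ε)} ≤
      ENNReal.ofReal ((1 + Real.sqrt 2 * Real.exp (-(2 * L))) ^ p - 1) := by
  classical
  set x := Real.sqrt 2 * Real.exp (-(2 * L)) with hx
  have hx0 : 0 ≤ x := by positivity
  have hsub : {ε : Fin n → ℝ | ¬ NoiseControlled Z L (Φ *ᵥ ε)} ⊆
      ⋃ S ∈ (Finset.univ.erase (∅ : Finset (Fin p))), {ε | ∃ v : Fin p → ℝ, (∀ j ∉ S, v j = 0) ∧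
        4 * Real.sqrt (S.card * L) * l2norm (Z *ᵥ v) < (Φ *ᵥ ε) ⬝ᵥ (Z *ᵥ v)} := by
    intro ε hε
    simp only [NoiseControlled, Set.mem_ofPred_eq, not_forall, not_le] at hε
    obtain ⟨S, v, hv, hlt⟩ := hε
    simp only [Set.mem_iUnion]
    refine ⟨S, ?_, v, hv, hlt⟩
    simp only [Finset.mem_erase, Finset.mem_univ, and_true]
    rintro rfl
    have : v = 0 := funext fun j => hv j (by simp)
    subst this
    simp at hlt
  refine (measure_mono hsub).trans ((measure_biUnion_finset_le _ _).trans ?_)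
  refine (Finset.sum_le_sum fun S _ => noiseLaw_span_le Φ hΦ Z S hL).trans ?_
  rw [← ENNReal.ofReal_sum_of_nonneg fun S _ => by positivity]
  refine ENNReal.ofReal_le_ofReal (le_of_eq ?_)
  rw [← sum_finset_pow_card, Finset.sum_erase_eq_sub (Finset.mem_univ _)]
  simp [hx]

/-- The log-likelihood ratio of `b + δ` versus `b`, when the noise is `e`. -/
def logRatio {m p : ℕ} (Z : Matrix (Fin m) (Fin p) ℝ) (e : Fin m → ℝ) (δ : Fin p → ℝ) : ℝ :=
  e ⬝ᵥ (Z *ᵥ δ) - (Z *ᵥ δ) ⬝ᵥ (Z *ᵥ δ) / 2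

/-- With `u = Z δ`, the Gaussian mean is `exp (t² |Φᵀ u|² / 2 - t |u|² / 2)`, and `t (1 + d) ≤ 1`
makes the exponent nonpositive. The fractional power compensates for the misspecified covariance. -/
lemma lintegral_exp_logRatio_le {m n p : ℕ} (Φ : Matrix (Fin m) (Fin n) ℝ)
    (Z : Matrix (Fin m) (Fin p) ℝ) (δ : Fin p → ℝ) {t d : ℝ} (ht : 0 ≤ t) (htd : t * (1 + d) ≤ 1)
    (hΦ : ∀ x, (Φᵀ *ᵥ x) ⬝ᵥ (Φᵀ *ᵥ x) ≤ (1 + d) * (x ⬝ᵥ x)) :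
    ∫⁻ ε, ENNReal.ofReal (Real.exp (t * logRatio Z (Φ *ᵥ ε) δ)) ∂(noiseLaw n) ≤ 1 := by
  set u := Z *ᵥ δ with hu
  have h : ∀ ε, ENNReal.ofReal (Real.exp (t * logRatio Z (Φ *ᵥ ε) δ)) =
      ENNReal.ofReal (Real.exp (-(t * (u ⬝ᵥ u) / 2))) *
        ENNReal.ofReal (Real.exp ((t • (Φᵀ *ᵥ u)) ⬝ᵥ ε)) := by
    intro ε
    rw [← ENNReal.ofReal_mul (Real.exp_pos _).le, ← Real.exp_add, logRatio, ← hu]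
    congr 2
    rw [smul_dotProduct, smul_eq_mul, Matrix.mulVec_transpose, ← Matrix.dotProduct_mulVec,
      dotProduct_comm u (Φ *ᵥ ε)]
    ring
  simp_rw [h]
  rw [lintegral_const_mul' _ _ ENNReal.ofReal_ne_top, lintegral_exp_dotProduct_noiseLaw,
    ← ENNReal.ofReal_mul (Real.exp_pos _).le, ← Real.exp_add, ENNReal.ofReal_le_one,
    Real.exp_le_one_iff]
  rw [smul_dotProduct, dotProduct_smul, smul_eq_mul, smul_eq_mul]
  have h1 := hΦ u
  have h2 := dotProduct_self_nonneg_real u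
  nlinarith [mul_le_mul_of_nonneg_left h1 (mul_nonneg ht ht),
    mul_le_mul_of_nonneg_right (mul_le_mul_of_nonneg_left htd ht) h2]

/-! ### Bounds for the log-likelihood ratio -/

section logRatio

variable {m p : ℕ} {Z : Matrix (Fin m) (Fin p) ℝ} {e : Fin m → ℝ} {L l R : ℝ}

lemma abs_dotProduct_col_le (he : NoiseControlled Z L e)
    (hcol : ∀ j, l2norm (fun i => Z i j) ≤ 2 * Real.sqrt m) (j : Fin p) :
    |e ⬝ᵥ (fun i => Z i j)| ≤ 8 * Real.sqrt L * Real.sqrt m := by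
  have key : ∀ σ : ℝ, |σ| = 1 → σ * (e ⬝ᵥ (fun i => Z i j)) ≤ 8 * Real.sqrt L * Real.sqrt m := by
    intro σ hσ
    have h := he {j} (Pi.single j σ) (fun k hk => by
      rw [Pi.single_eq_of_ne]; simpa using hk)
    have h1 : Z *ᵥ (Pi.single j σ) = σ • fun i => Z i j := by
      rw [Matrix.mulVec_single]; ext i; simp [mul_comm]
    rw [h1, dotProduct_smul, l2norm_smul, hσ, one_mul, smul_eq_mul, Finset.card_singleton,
      Nat.cast_one, one_mul] at h
    refine h.trans ?_
    calc 4 * Real.sqrt L * l2norm (fun i => Z i j) ≤ 4 * Real.sqrt L * (2 * Real.sqrt m) :=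
          mul_le_mul_of_nonneg_left (hcol j) (by positivity)
      _ = 8 * Real.sqrt L * Real.sqrt m := by ring
  rw [abs_le]
  have h1 := key 1 (by simp)
  have h2 := key (-1) (by simp)
  constructor <;> linarith

/-- For vectors that are small rather than sparse: expand over the columns, use the control on
singletons, and conclude with `√m R = √l`. -/
lemma abs_dotProduct_mulVec_le (he : NoiseControlled Z L e)
    (hcol : ∀ j, l2norm (fun i => Z i j) ≤ 2 * Real.sqrt m) (hL : 0 ≤ L) (hLl : L ≤ l)
    (hR : m * R ^ 2 = l) (hR0 : 0 ≤ R) {v : Fin p → ℝ} (hv : ∑ j, |v j| ≤ R) :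
    |e ⬝ᵥ (Z *ᵥ v)| ≤ 8 * l := by
  have hsq : Real.sqrt m * R = Real.sqrt l := by
    rw [← hR, Real.sqrt_mul (Nat.cast_nonneg _), Real.sqrt_sq hR0]
  calc |e ⬝ᵥ (Z *ᵥ v)| = |∑ j, v j * (e ⬝ᵥ (fun i => Z i j))| := by
        rw [mulVec_eq_sum_smul_col, dotProduct_sum]
        simp only [dotProduct_smul, smul_eq_mul]
    _ ≤ ∑ j, |v j| * (8 * Real.sqrt L * Real.sqrt m) := by
        refine (Finset.abs_sum_le_sum_abs _ _).trans (Finset.sum_le_sum fun j _ => ?_)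
        rw [abs_mul]
        exact mul_le_mul_of_nonneg_left (abs_dotProduct_col_le he hcol j) (abs_nonneg _)
    _ ≤ R * (8 * Real.sqrt L * Real.sqrt m) := by
        rw [← Finset.sum_mul]
        exact mul_le_mul_of_nonneg_right hv (by positivity)
    _ = 8 * (Real.sqrt L * Real.sqrt l) := by rw [← hsq]; ring
    _ ≤ 8 * (Real.sqrt l * Real.sqrt l) := by
        have := Real.sqrt_le_sqrt hLl
        gcongr
    _ = 8 * l := by rw [Real.mul_self_sqrt (hL.trans hLl)]

lemma mulVec_dotProduct_self_le
    (hcol : ∀ j, l2norm (fun i => Z i j) ≤ 2 * Real.sqrt m)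
    (hR : m * R ^ 2 = l) {v : Fin p → ℝ} (hv : ∑ j, |v j| ≤ R) :
    (Z *ᵥ v) ⬝ᵥ (Z *ᵥ v) ≤ 4 * l := by
  rw [← l2norm_sq]
  have h1 : l2norm (Z *ᵥ v) ≤ 2 * Real.sqrt m * R :=
    (l2norm_mulVec_le hcol v).trans (mul_le_mul_of_nonneg_left hv (by positivity))
  calc l2norm (Z *ᵥ v) ^ 2 ≤ (2 * Real.sqrt m * R) ^ 2 := pow_le_pow_left₀ (l2norm_nonneg _) h1 2
    _ = 4 * (Real.sqrt m ^ 2 * R ^ 2) := by ring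
    _ = 4 * l := by rw [Real.sq_sqrt (Nat.cast_nonneg _), hR]

lemma le_logRatio (he : NoiseControlled Z L e)
    (hcol : ∀ j, l2norm (fun i => Z i j) ≤ 2 * Real.sqrt m) (hL : 0 ≤ L) (hLl : L ≤ l)
    (hR : m * R ^ 2 = l) (hR0 : 0 ≤ R) {δ : Fin p → ℝ} (hδ : ∑ j, |δ j| ≤ R) :
    -(10 * l) ≤ logRatio Z e δ := by
  have h1 := abs_le.1 (abs_dotProduct_mulVec_le he hcol hL hLl hR hR0 hδ)
  have h2 := mulVec_dotProduct_self_le hcol hR hδ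
  rw [logRatio]
  linarith [h1.1]

/-- The restriction of a vector to a set of coordinates. -/
def restrictTo {p : ℕ} (S : Finset (Fin p)) (v : Fin p → ℝ) (j : Fin p) : ℝ :=
  if j ∈ S then v j else 0

/-- Split `Z δ` into its sparse part `u` and a small part `w`. The small part costs `O(l)`; for the
sparse part, the noise term is absorbed by a fraction of `|u|²` through Young's inequality. -/
lemma logRatio_le (he : NoiseControlled Z L e)
    (hcol : ∀ j, l2norm (fun i => Z i j) ≤ 2 * Real.sqrt m) (hL : 0 ≤ L) (hLl : L ≤ l)
    (hR : m * R ^ 2 = l) (hR0 : 0 ≤ R) (S : Finset (Fin p)) {δ : Fin p → ℝ}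
    (hδ : ∑ j, |(δ - restrictTo S δ) j| ≤ R) :
    logRatio Z e δ ≤ 10 * l + 32 * (S.card * L) -
      (Z *ᵥ restrictTo S δ) ⬝ᵥ (Z *ᵥ restrictTo S δ) / 8 := by
  have h1 := abs_le.1 (abs_dotProduct_mulVec_le he hcol hL hLl hR hR0 hδ)
  have h2 := mulVec_dotProduct_self_le hcol hR hδ
  have h3 := he S (restrictTo S δ) (fun j hj => by simp [restrictTo, hj])
  have hdec : Z *ᵥ δ = Z *ᵥ restrictTo S δ + Z *ᵥ (δ - restrictTo S δ) := by
    rw [← Matrix.mulVec_add, add_sub_cancel]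
  set u := Z *ᵥ restrictTo S δ
  set w := Z *ᵥ (δ - restrictTo S δ)
  -- This square bounds the cross term: `-u ⬝ w ≤ |u|² / 4 + |w|²`, leaving `-|u|² / 4` in the
  -- log-ratio. Half of that pays for the noise in `h7`.
  have h4 : 0 ≤ (u + (2 : ℝ) • w) ⬝ᵥ (u + (2 : ℝ) • w) := dotProduct_self_nonneg_real _
  have h5 : (u + w) ⬝ᵥ (u + w) = u ⬝ᵥ u + 2 * (u ⬝ᵥ w) + w ⬝ᵥ w := by
    simp only [add_dotProduct, dotProduct_add]
    rw [dotProduct_comm w u]; ring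
  have h6 : (u + (2 : ℝ) • w) ⬝ᵥ (u + (2 : ℝ) • w) = u ⬝ᵥ u + 4 * (u ⬝ᵥ w) + 4 * (w ⬝ᵥ w) := by
    simp only [add_dotProduct, dotProduct_add, smul_dotProduct, dotProduct_smul, smul_eq_mul]
    rw [dotProduct_comm w u]; ring
  rw [logRatio, hdec, dotProduct_add, h5]
  rw [← l2norm_sq u] at h6 ⊢
  have h7 : 4 * Real.sqrt (S.card * L) * l2norm u ≤ 32 * (S.card * L) + l2norm u ^ 2 / 8 := by
    have h8 : 0 ≤ (16 * Real.sqrt (S.card * L) - l2norm u) ^ 2 := sq_nonneg _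
    have h9 : Real.sqrt (S.card * L) ^ 2 = S.card * L := Real.sq_sqrt (by positivity)
    nlinarith
  linarith [h1.2]

end logRatio

/-! ### The posterior for a given sketching matrix -/

lemma likelihood_add {m p : ℕ} (Z : Matrix (Fin m) (Fin p) ℝ) (βs β : Fin p → ℝ)
    (e : Fin m → ℝ) :
    likelihood Z (Z *ᵥ βs + e) β = (∏ i, gaussianPDF 0 1 (e i)) *
      ENNReal.ofReal (Real.exp (logRatio Z e (β - βs))) := by
  have h : logRatio Z e (β - βs) =
      ∑ i, (e i * (Z *ᵥ (β - βs)) i - (Z *ᵥ (β - βs)) i ^ 2 / 2) := by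
    rw [logRatio, Finset.sum_sub_distrib, ← Finset.sum_div]
    simp only [dotProduct, sq]
  rw [h, Real.exp_sum, ENNReal.ofReal_prod_of_nonneg fun i _ => (Real.exp_pos _).le,
    ← Finset.prod_mul_distrib, likelihood]
  refine Finset.prod_congr rfl fun i _ => ?_
  rw [gaussianPDF, gaussianPDF, ← ENNReal.ofReal_mul (gaussianPDFReal_nonneg _ _ _),
    gaussianPDFReal, gaussianPDFReal, mul_assoc _ (Real.exp _) (Real.exp _), ← Real.exp_add]
  congr 3
  rw [Matrix.mulVec_sub]
  simp only [NNReal.coe_one, Pi.add_apply, Pi.sub_apply]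
  ring

lemma posterior_eq {m p : ℕ} (π : Measure (Fin p → ℝ)) (Z : Matrix (Fin m) (Fin p) ℝ)
    (βs : Fin p → ℝ) (e : Fin m → ℝ) (C : Set (Fin p → ℝ)) :
    posterior π Z (Z *ᵥ βs + e) C =
      (∫⁻ β in C, ENNReal.ofReal (Real.exp (logRatio Z e (β - βs))) ∂π) /
        ∫⁻ β, ENNReal.ofReal (Real.exp (logRatio Z e (β - βs))) ∂π := by
  have h0 : ∏ i, gaussianPDF 0 1 (e i) ≠ 0 :=
    Finset.prod_ne_zero_iff.2 fun i _ => (gaussianPDF_pos _ one_ne_zero _).ne'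
  have h1 : ∏ i, gaussianPDF 0 1 (e i) ≠ ∞ :=
    ENNReal.prod_ne_top fun i _ => gaussianPDF_ne_top
  rw [posterior]
  simp_rw [likelihood_add]
  rw [lintegral_const_mul' _ _ h1, lintegral_const_mul' _ _ h1, ENNReal.mul_div_mul_left _ _ h0 h1]

lemma posterior_le_one {m p : ℕ} (π : Measure (Fin p → ℝ)) (Z : Matrix (Fin m) (Fin p) ℝ)
    (y : Fin m → ℝ) (C : Set (Fin p → ℝ)) : posterior π Z y C ≤ 1 :=
  (ENNReal.div_le_div_right (setLIntegral_le_lintegral _ _) _).trans ENNReal.div_self_le_one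

lemma expectedPosterior_le_one {m n p : ℕ} (π : Measure (Fin p → ℝ))
    (X : Matrix (Fin n) (Fin p) ℝ) (βs : Fin p → ℝ) (C : Set (Fin p → ℝ))
    (Φ : Matrix (Fin m) (Fin n) ℝ) : expectedPosterior π X βs C Φ ≤ 1 := by
  calc expectedPosterior π X βs C Φ ≤ ∫⁻ _, 1 ∂(noiseLaw n) :=
        lintegral_mono fun ε => posterior_le_one _ _ _ _
    _ = 1 := by simp

/-- Passing to a measurable hull of `B` lets the exceptional events be used without proving them
measurable. -/
lemma lintegral_le_measure_add {Ω : Type*} [MeasurableSpace Ω] (P : Measure Ω) {f g : Ω → ℝ≥0∞}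
    {B : Set Ω} (hf : ∀ ω, f ω ≤ 1) (hg : ∀ ω ∉ B, f ω ≤ g ω) :
    ∫⁻ ω, f ω ∂P ≤ P B + ∫⁻ ω, g ω ∂P := by
  classical
  calc ∫⁻ ω, f ω ∂P ≤ ∫⁻ ω, ((toMeasurable P B).indicator 1 ω + g ω) ∂P := by
        refine lintegral_mono fun ω => ?_
        by_cases h : ω ∈ toMeasurable P B
        · simp only [Set.indicator_of_mem h, Pi.one_apply]
          exact (hf ω).trans le_self_add
        · simp only [Set.indicator_of_notMem h, zero_add]
          exact hg ω fun hB => h (subset_toMeasurable P B hB)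
    _ = P B + ∫⁻ ω, g ω ∂P := by
        rw [lintegral_add_left (measurable_one.indicator (measurableSet_toMeasurable P B)),
          lintegral_indicator_one (measurableSet_toMeasurable P B), measure_toMeasurable]

/-- The number of coordinates of absolute value at least `a`. -/
def numLarge {p : ℕ} (a : ℝ) (β : Fin p → ℝ) : ℕ := (Finset.univ.filter fun j => a ≤ |β j|).card

lemma ofReal_exp_mul_numLarge {p : ℕ} (a c : ℝ) (β : Fin p → ℝ) :
    ENNReal.ofReal (Real.exp (c * numLarge a β)) =
      ∏ j, if a ≤ |β j| then ENNReal.ofReal (Real.exp c) else 1 := by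
  classical
  rw [Finset.prod_ite, Finset.prod_const, Finset.prod_const_one, mul_one, numLarge, mul_comm,
    Real.exp_nat_mul, ENNReal.ofReal_pow (Real.exp_pos _).le]

lemma measurable_ite_le_abs (a : ℝ) (c : ℝ≥0∞) :
    Measurable fun x : ℝ => if a ≤ |x| then c else 1 :=
  Measurable.ite (measurableSet_le measurable_const measurable_norm) measurable_const
    measurable_const

lemma measurable_exp_mul_numLarge {p : ℕ} (a c : ℝ) :
    Measurable fun β : Fin p → ℝ => ENNReal.ofReal (Real.exp (c * numLarge a β)) := by
  simp_rw [ofReal_exp_mul_numLarge]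
  exact Finset.measurable_prod _ fun j _ =>
    (measurable_ite_le_abs a _).comp (measurable_pi_apply j)

lemma sum_abs_le_of_forall_le {p : ℕ} {a R : ℝ} (hpa : p * a ≤ R) {v : Fin p → ℝ}
    (hv : ∀ j, |v j| ≤ a) : ∑ j, |v j| ≤ R :=
  (Finset.sum_le_sum fun j _ => hv j).trans (by simpa using hpa)

/-- The posterior probability of the exceptional set, given a well-behaved sketching matrix. -/
theorem expectedPosterior_le {m n p : ℕ} (π : Measure (Fin p → ℝ)) [IsProbabilityMeasure π]
    (X : Matrix (Fin n) (Fin p) ℝ) (βs : Fin p → ℝ) (Φ : Matrix (Fin m) (Fin n) ℝ)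
    {A : ℕ} {L R a d u κ B Q E : ℝ} (hA : 1 ≤ A) (hs : 1 ≤ sparsity βs) (hL : 0 ≤ L)
    (hR0 : 0 ≤ R) (ha : 0 ≤ a) (hpa : p * a ≤ R) (hR : m * R ^ 2 = sparsity βs * L)
    (hcol : ∀ j, l2norm (fun i => (Φ * X) i j) ≤ 2 * Real.sqrt m) (hd0 : 0 ≤ d) (hd1 : d ≤ 1)
    (hdu : 74 * d ≤ u / 2)
    (hΦ : ∀ x, (Φᵀ *ᵥ x) ⬝ᵥ (Φᵀ *ᵥ x) ≤ (1 + d) * (x ⬝ᵥ x)) (hκ : 0 ≤ κ)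
    (hRE : ∀ S, activeSet βs ⊆ S → S.card ≤ (A + 1) * sparsity βs → ∀ v : Fin p → ℝ,
      (∀ j ∉ S, v j = 0) → κ * m * (v ⬝ᵥ v) ≤ ((Φ * X) *ᵥ v) ⬝ᵥ ((Φ * X) *ᵥ v))
    (hbox : ENNReal.ofReal (Real.exp (-(B * (sparsity βs * L)))) ≤
      π {β | ∀ j, |β j - βs j| ≤ a}) (hQ0 : 0 ≤ Q)
    (hQ : ∫⁻ β, ENNReal.ofReal (Real.exp (u * L * numLarge a β)) ∂π ≤ ENNReal.ofReal Q)
    (hE : 1 ≤ E) :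
    expectedPosterior π X βs (exceptionalSet βs (E * R) a (A * sparsity βs)) Φ ≤
      ENNReal.ofReal ((1 + Real.sqrt 2 * Real.exp (-(2 * L))) ^ p - 1) +
      ENNReal.ofReal (Real.exp ((B + 10) * (sparsity βs * L)) *
        (Q * Real.exp (-(u / 2 * A * (sparsity βs * L))) +
          Real.exp ((42 + 32 * A - κ * E ^ 2 / 2) * (sparsity βs * L)))) := by
  classical
  set s := sparsity βs with hs_def
  set l : ℝ := s * L with hl_def
  set Z := Φ * X with hZ
  have hs1 : (1 : ℝ) ≤ s := by exact_mod_cast hs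
  have hLl : L ≤ l := by rw [hl_def]; nlinarith
  have hl0 : 0 ≤ l := hL.trans hLl
  -- The largest power of the likelihood ratio whose mean is guaranteed to be at most one.
  set t : ℝ := 1 / (1 + d) with ht
  have ht0 : 0 ≤ t := by positivity
  have ht1 : t ≤ 1 := by rw [ht, div_le_one (by linarith)]; linarith
  have htd : t * (1 + d) ≤ 1 := by rw [ht]; field_simp; rfl
  have htd' : 1 - t ≤ d := by
    have : t * (1 + d) = 1 := by rw [ht]; field_simp
    nlinarith
  let lr : (Fin n → ℝ) → (Fin p → ℝ) → ℝ := fun ε β => logRatio Z (Φ *ᵥ ε) (β - βs)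
  let bad : Set (Fin n → ℝ) := {ε | ¬ NoiseControlled Z L (Φ *ᵥ ε)}
  let c₀ : ℝ≥0∞ := ENNReal.ofReal (Real.exp (-(u / 2 * A * l)))
  let G : (Fin n → ℝ) → (Fin p → ℝ) → ℝ≥0∞ := fun ε β =>
    c₀ * (ENNReal.ofReal (Real.exp (u * L * numLarge a β)) *
      ENNReal.ofReal (Real.exp (t * lr ε β)))
  let c₁ : ℝ≥0∞ := ENNReal.ofReal (Real.exp ((B + 10) * l))
  let c₂ : ℝ≥0∞ := ENNReal.ofReal (Real.exp ((42 + 32 * A - κ * E ^ 2 / 2) * l))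
  have hlr_cont : Continuous fun q : (Fin n → ℝ) × (Fin p → ℝ) => lr q.1 q.2 := by
    simp only [lr, logRatio, dotProduct, Matrix.mulVec, Pi.sub_apply]
    fun_prop
  have hG_meas : Measurable (Function.uncurry G) := by
    have h1 : Measurable fun q : (Fin n → ℝ) × (Fin p → ℝ) =>
        ENNReal.ofReal (Real.exp (u * L * numLarge a q.2)) :=
      (measurable_exp_mul_numLarge a (u * L)).comp measurable_snd
    have h2 : Measurable fun q : (Fin n → ℝ) × (Fin p → ℝ) =>
        ENNReal.ofReal (Real.exp (t * lr q.1 q.2)) := by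
      have := hlr_cont.measurable
      fun_prop
    exact (h1.mul h2).const_mul c₀
  -- the support that carries the large coordinates and the truth
  let S : (Fin p → ℝ) → Finset (Fin p) := fun β =>
    (Finset.univ.filter fun j => a ≤ |β j|) ∪ activeSet βs
  have hScard : ∀ β, ((S β).card : ℝ) ≤ numLarge a β + s := fun β => by
    exact_mod_cast Finset.card_union_le _ _
  have hSsmall : ∀ β j, |((β - βs) - restrictTo (S β) (β - βs)) j| ≤ a := by
    intro β j
    by_cases hj : j ∈ S β
    · simpa [restrictTo, hj] using ha
    · have h1 : βs j = 0 := by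
        by_contra h
        exact hj (Finset.mem_union_right _ (by simpa [activeSet] using h))
      have h2 : |β j| < a := by
        by_contra h
        exact hj (Finset.mem_union_left _ (by simpa using h))
      simpa [restrictTo, hj, h1] using h2.le
  have hupper : ∀ ε ∉ bad, ∀ β, lr ε β ≤ 42 * l + 32 * (numLarge a β * L) -
      (Z *ᵥ restrictTo (S β) (β - βs)) ⬝ᵥ (Z *ᵥ restrictTo (S β) (β - βs)) / 8 := by
    intro ε hε β
    have h := logRatio_le (not_not.1 hε) hcol hL hLl hR hR0 (S β)
      (sum_abs_le_of_forall_le hpa (hSsmall β))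
    have h' := mul_le_mul_of_nonneg_right (hScard β) hL
    simp only [lr]
    linarith
  have hmany : ∀ ε ∉ bad, ∀ β, A * s ≤ numLarge a β →
      ENNReal.ofReal (Real.exp (lr ε β)) ≤ G ε β := by
    intro ε hε β hβ
    have h1 := hupper ε hε β
    have h2 := dotProduct_self_nonneg_real (Z *ᵥ restrictTo (S β) (β - βs))
    have h3 : (A : ℝ) * s ≤ numLarge a β := by exact_mod_cast hβ
    have hA1 : (1 : ℝ) ≤ A := by exact_mod_cast hA
    have h4 : (s : ℝ) ≤ numLarge a β := by nlinarith
    set K : ℝ := (numLarge a β : ℝ)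
    have h5 : l ≤ K * L := mul_le_mul_of_nonneg_right h4 hL
    -- `74 = 42 + 32`, since `l ≤ K L`. Hence the leftover power `1 - t ≤ d` costs at most `(u / 2)
    -- K L`; the other half of `u K L` supplies the gain `exp (-(u / 2) A l)` because `K ≥ A s`.
    have h6 : lr ε β ≤ 74 * (K * L) := by linarith
    have hKL : 0 ≤ K * L := hl0.trans h5
    have h7 : (1 - t) * lr ε β ≤ u / 2 * (K * L) := by
      calc (1 - t) * lr ε β ≤ (1 - t) * (74 * (K * L)) :=
            mul_le_mul_of_nonneg_left h6 (by linarith)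
        _ ≤ d * (74 * (K * L)) := mul_le_mul_of_nonneg_right htd' (by linarith)
        _ = 74 * d * (K * L) := by ring
        _ ≤ u / 2 * (K * L) := mul_le_mul_of_nonneg_right hdu hKL
    have h8 : A * l ≤ K * L := by
      rw [hl_def, ← mul_assoc]; exact mul_le_mul_of_nonneg_right h3 hL
    have hu : 0 ≤ u := by linarith
    simp only [G, c₀]
    rw [← ENNReal.ofReal_mul (Real.exp_pos _).le, ← ENNReal.ofReal_mul (Real.exp_pos _).le,
      ← Real.exp_add, ← Real.exp_add]
    refine ENNReal.ofReal_le_ofReal (Real.exp_le_exp.2 ?_)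
    nlinarith [mul_le_mul_of_nonneg_left h8 hu]
  have hfar : ∀ ε ∉ bad, ∀ β, numLarge a β < A * s → 3 * (E * R) < l2norm (β - βs) →
      ENNReal.ofReal (Real.exp (lr ε β)) ≤ c₂ := by
    intro ε hε β hβ hdist
    have h1 := hupper ε hε β
    have h3 : (numLarge a β : ℝ) ≤ A * s := by exact_mod_cast hβ.le
    have hcard : (S β).card ≤ (A + 1) * s := by
      have : (S β).card ≤ numLarge a β + s := Finset.card_union_le _ _
      nlinarith
    have h4 := hRE (S β) Finset.subset_union_right hcard (restrictTo (S β) (β - βs))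
      (fun j hj => by simp [restrictTo, hj])
    have h5 : l2norm (β - βs) ≤ l2norm (restrictTo (S β) (β - βs)) + R := by
      calc l2norm (β - βs) = l2norm (restrictTo (S β) (β - βs) +
            ((β - βs) - restrictTo (S β) (β - βs))) := by rw [add_sub_cancel]
        _ ≤ _ := (l2norm_add_le _ _).trans (add_le_add_right ((l2norm_le_sum_abs _).trans
            (sum_abs_le_of_forall_le hpa (hSsmall β))) _)
    have h6 : 2 * (E * R) ≤ l2norm (restrictTo (S β) (β - βs)) := by nlinarith
    have h7 : (2 * (E * R)) ^ 2 ≤ l2norm (restrictTo (S β) (β - βs)) ^ 2 :=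
      pow_le_pow_left₀ (by positivity) h6 2
    rw [l2norm_sq] at h7
    have h8 := mul_le_mul_of_nonneg_left h7 (mul_nonneg hκ (Nat.cast_nonneg m))
    have h9 : κ * m * (2 * (E * R)) ^ 2 = 4 * κ * E ^ 2 * l := by rw [← hR]; ring
    have h10 : (numLarge a β : ℝ) * L ≤ A * l := by
      rw [hl_def, ← mul_assoc]; exact mul_le_mul_of_nonneg_right h3 hL
    refine ENNReal.ofReal_le_ofReal (Real.exp_le_exp.2 ?_)
    rw [h9] at h8
    have := h8.trans h4
    nlinarith
  have hden : ∀ ε ∉ bad, ENNReal.ofReal (Real.exp (-((B + 10) * l))) ≤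
      ∫⁻ β, ENNReal.ofReal (Real.exp (lr ε β)) ∂π := by
    intro ε hε
    have hboxmeas : MeasurableSet {β : Fin p → ℝ | ∀ j, |β j - βs j| ≤ a} := by
      rw [show {β : Fin p → ℝ | ∀ j, |β j - βs j| ≤ a} = ⋂ j, {β | |β j - βs j| ≤ a} by
        ext; simp]
      exact MeasurableSet.iInter fun j => measurableSet_le (by fun_prop) measurable_const
    calc ENNReal.ofReal (Real.exp (-((B + 10) * l)))
        = ENNReal.ofReal (Real.exp (-(10 * l))) * ENNReal.ofReal (Real.exp (-(B * l))) := by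
          rw [← ENNReal.ofReal_mul (Real.exp_pos _).le, ← Real.exp_add]; congr 2; ring
      _ ≤ ENNReal.ofReal (Real.exp (-(10 * l))) * π {β | ∀ j, |β j - βs j| ≤ a} := by gcongr
      _ = ∫⁻ β in {β | ∀ j, |β j - βs j| ≤ a}, ENNReal.ofReal (Real.exp (-(10 * l))) ∂π := by
          rw [setLIntegral_const]
      _ ≤ ∫⁻ β in {β | ∀ j, |β j - βs j| ≤ a}, ENNReal.ofReal (Real.exp (lr ε β)) ∂π := by
          refine setLIntegral_mono' hboxmeas fun β hβ => ?_
          refine ENNReal.ofReal_le_ofReal (Real.exp_le_exp.2 ?_)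
          exact le_logRatio (not_not.1 hε) hcol hL hLl hR hR0 (sum_abs_le_of_forall_le hpa hβ)
      _ ≤ _ := setLIntegral_le_lintegral _ _
  have hpost : ∀ ε ∉ bad, posterior π Z (Φ *ᵥ (X *ᵥ βs + ε))
      (exceptionalSet βs (E * R) a (A * s)) ≤ c₁ * (∫⁻ β, G ε β ∂π + c₂) := by
    intro ε hε
    have h0 : Φ *ᵥ (X *ᵥ βs + ε) = Z *ᵥ βs + Φ *ᵥ ε := by
      rw [Matrix.mulVec_add, Matrix.mulVec_mulVec]
    rw [h0, posterior_eq]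
    have hnum : ∫⁻ β in exceptionalSet βs (E * R) a (A * s),
        ENNReal.ofReal (Real.exp (logRatio Z (Φ *ᵥ ε) (β - βs))) ∂π ≤ ∫⁻ β, G ε β ∂π + c₂ := by
      have hsub : exceptionalSet βs (E * R) a (A * s) ⊆ {β | A * s ≤ numLarge a β} ∪
          {β | numLarge a β < A * s ∧ 3 * (E * R) < l2norm (β - βs)} := by
        rintro β (h | h)
        · rcases le_or_gt (A * s) (numLarge a β) with h' | h'
          · exact Or.inl h'
          · exact Or.inr ⟨h', h⟩
        · exact Or.inl h
      refine (lintegral_mono_set hsub).trans ((lintegral_union_le _ _ _).trans (add_le_add ?_ ?_))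
      · refine (setLIntegral_mono (hG_meas.comp measurable_prodMk_left) fun β hβ =>
          hmany ε hε β hβ).trans (setLIntegral_le_lintegral _ _)
      · refine (setLIntegral_mono measurable_const fun β hβ =>
          hfar ε hε β hβ.1 hβ.2).trans ((setLIntegral_le_lintegral _ _).trans ?_)
        simp
    have hc : (ENNReal.ofReal (Real.exp (-((B + 10) * l))))⁻¹ = c₁ := by
      rw [← ENNReal.ofReal_inv_of_pos (Real.exp_pos _), ← Real.exp_neg, neg_neg]
    rw [ENNReal.div_eq_inv_mul, ← hc]
    exact mul_le_mul' (ENNReal.inv_le_inv.2 (hden ε hε)) hnum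
  have hΦ2 : ∀ x, (Φᵀ *ᵥ x) ⬝ᵥ (Φᵀ *ᵥ x) ≤ 2 * (x ⬝ᵥ x) := fun x =>
    (hΦ x).trans (mul_le_mul_of_nonneg_right (by linarith) (dotProduct_self_nonneg_real x))
  have hEG : ∫⁻ ε, ∫⁻ β, G ε β ∂π ∂(noiseLaw n) ≤ c₀ * ENNReal.ofReal Q := by
    -- Averaging over the noise first removes the likelihood, because the weight in `numLarge`
    -- depends on `β` only; a prior moment remains.
    rw [lintegral_lintegral_swap hG_meas.aemeasurable]
    calc ∫⁻ β, ∫⁻ ε, G ε β ∂(noiseLaw n) ∂π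
        ≤ ∫⁻ β, c₀ * ENNReal.ofReal (Real.exp (u * L * numLarge a β)) ∂π := by
          refine lintegral_mono fun β => ?_
          simp only [G]
          rw [lintegral_const_mul' _ _ ENNReal.ofReal_ne_top,
            lintegral_const_mul' _ _ ENNReal.ofReal_ne_top]
          refine mul_le_mul_right ((mul_le_mul_right
            (lintegral_exp_logRatio_le Φ Z (β - βs) ht0 htd hΦ) _).trans (mul_one _).le) _
      _ ≤ c₀ * ENNReal.ofReal Q := by
          rw [lintegral_const_mul' _ _ ENNReal.ofReal_ne_top]
          exact mul_le_mul_right hQ _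
  rw [expectedPosterior]
  refine (lintegral_le_measure_add (noiseLaw n) (B := bad)
    (fun ε => posterior_le_one _ _ _ _) hpost).trans ?_
  refine add_le_add (noiseLaw_not_noiseControlled_le Φ hΦ2 Z hL) ?_
  rw [lintegral_const_mul' _ _ ENNReal.ofReal_ne_top, lintegral_add_right _ measurable_const,
    ENNReal.ofReal_mul (Real.exp_pos _).le,
    ENNReal.ofReal_add (mul_nonneg hQ0 (Real.exp_pos _).le) (Real.exp_pos _).le]
  refine mul_le_mul_right (add_le_add ?_ ?_) _
  · rw [mul_comm Q, ENNReal.ofReal_mul (Real.exp_pos _).le]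
    exact hEG
  · simp [c₂]

/-! ### The sketching matrix -/

lemma dotProduct_mulVec_transpose_self {m n : ℕ} (Φ : Matrix (Fin m) (Fin n) ℝ) {d : ℝ}
    (h : spectralNorm (Φ * Φᵀ - 1) ≤ d) (x : Fin m → ℝ) :
    (Φᵀ *ᵥ x) ⬝ᵥ (Φᵀ *ᵥ x) ≤ (1 + d) * (x ⬝ᵥ x) := by
  have h1 : (Φᵀ *ᵥ x) ⬝ᵥ (Φᵀ *ᵥ x) = x ⬝ᵥ x + x ⬝ᵥ ((Φ * Φᵀ - 1) *ᵥ x) := by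
    rw [Matrix.sub_mulVec, Matrix.one_mulVec, dotProduct_sub, add_sub_cancel,
      ← Matrix.mulVec_mulVec, Matrix.dotProduct_mulVec x, Matrix.mulVec_transpose]
  have h2 : x ⬝ᵥ ((Φ * Φᵀ - 1) *ᵥ x) ≤ d * (x ⬝ᵥ x) := by
    calc x ⬝ᵥ ((Φ * Φᵀ - 1) *ᵥ x) ≤ l2norm x * l2norm ((Φ * Φᵀ - 1) *ᵥ x) :=
          (le_abs_self _).trans (abs_dotProduct_le _ _)
      _ ≤ l2norm x * (spectralNorm (Φ * Φᵀ - 1) * l2norm x) := by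
          refine mul_le_mul_of_nonneg_left ?_ (l2norm_nonneg x)
          exact (Matrix.toEuclideanCLM (n := Fin m) (𝕜 := ℝ) (Φ * Φᵀ - 1)).le_opNorm
            (WithLp.toLp 2 x)
      _ ≤ l2norm x * (d * l2norm x) := by
          have := l2norm_nonneg x
          gcongr
      _ = d * (x ⬝ᵥ x) := by rw [← l2norm_sq]; ring
  rw [h1]; linarith

lemma continuous_spectralNorm (m : ℕ) : Continuous (spectralNorm (m := m)) :=
  continuous_norm.comp (LinearMap.continuous_of_finiteDimensional
    (Matrix.toEuclideanCLM (n := Fin m) (𝕜 := ℝ)).toAlgEquiv.toLinearMap)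

lemma measurableSet_spectralNorm_le (m n : ℕ) (c : ℝ) :
    MeasurableSet {Φ : Fin m → Fin n → ℝ |
      spectralNorm (Matrix.of Φ * (Matrix.of Φ)ᵀ - 1) ≤ c} := by
  refine IsClosed.measurableSet (isClosed_le ((continuous_spectralNorm m).comp ?_) continuous_const)
  have : Continuous fun Φ : Fin m → Fin n → ℝ => Matrix.of Φ := continuous_id
  fun_prop

/-- Subtracting `η` times the identity shifts the spectrum to the nonnegative half-line, so the
shifted Gram matrix is positive semidefinite. -/
lemma le_dotProduct_of_spectrum_gram {n p : ℕ} (X : Matrix (Fin n) (Fin p) ℝ)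
    (ξ : Finset (Fin p)) {η : ℝ} (h : ∀ e ∈ spectrum ℝ (gram X ξ), η ≤ e) (w : ξ → ℝ) :
    η * (w ⬝ᵥ w) ≤ (X.submatrix id (fun j : ξ => (j : Fin p)) *ᵥ w) ⬝ᵥ
      (X.submatrix id (fun j : ξ => (j : Fin p)) *ᵥ w) / n := by
  set Y := X.submatrix id (fun j : ξ => (j : Fin p)) with hY
  have hH : (gram X ξ).IsHermitian := by
    rw [Matrix.IsHermitian, gram, Matrix.conjTranspose_eq_transpose_of_trivial,
      Matrix.transpose_smul, Matrix.transpose_mul, Matrix.transpose_transpose]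
  have hH' : (-(algebraMap ℝ (Matrix ξ ξ ℝ) η) + gram X ξ).IsHermitian := by
    refine Matrix.IsHermitian.add ?_ hH
    rw [Matrix.IsHermitian, Matrix.conjTranspose_eq_transpose_of_trivial, Matrix.transpose_neg,
      Matrix.algebraMap_eq_diagonal, Matrix.diagonal_transpose]
  have hpos : (-(algebraMap ℝ (Matrix ξ ξ ℝ) η) + gram X ξ).PosSemidef := by
    rw [hH'.posSemidef_iff_eigenvalues_nonneg]
    intro i
    have h1 := hH'.eigenvalues_mem_spectrum_real i
    rw [← spectrum.add_mem_iff] at h1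
    have := h _ h1
    simpa using this
  have h2 := hpos.dotProduct_mulVec_nonneg w
  have h3 : (algebraMap ℝ (Matrix ξ ξ ℝ) η) *ᵥ w = η • w := by
    rw [Algebra.algebraMap_eq_smul_one, Matrix.smul_mulVec, Matrix.one_mulVec]
  have h4 : w ⬝ᵥ (gram X ξ *ᵥ w) = (Y *ᵥ w) ⬝ᵥ (Y *ᵥ w) / n := by
    rw [gram, ← hY, Matrix.smul_mulVec, dotProduct_smul, ← Matrix.mulVec_mulVec,
      Matrix.dotProduct_mulVec, Matrix.vecMul_transpose, smul_eq_mul]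
    ring
  rw [star_trivial, Matrix.add_mulVec, Matrix.neg_mulVec, h3, dotProduct_add, h4, dotProduct_neg,
    dotProduct_smul, smul_eq_mul] at h2
  linarith

lemma continuous_mulVec_sketch {m n : ℕ} (z : Fin n → ℝ) : Continuous fun Φ : Fin m → Fin n → ℝ =>
    (Matrix.of Φ *ᵥ z) ⬝ᵥ (Matrix.of Φ *ᵥ z) := by
  simp only [dotProduct, Matrix.mulVec, Matrix.of_apply]
  fun_prop

lemma sqrt_two_le_exp_half : Real.sqrt 2 ≤ Real.exp (1 / 2) := by
  rw [Real.sqrt_le_left (Real.exp_pos _).le, ← Real.exp_nat_mul]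
  have := Real.add_one_le_exp (1 : ℝ)
  norm_num at this ⊢
  linarith

/-- Chernoff at parameter `1/4`: the moment is at most `√2 ^ m ≤ exp (m / 2)`, against a gain `exp
(-m)`. -/
lemma sketchLaw_upper {m n : ℕ} (z : Fin n → ℝ) (hz : (z ⬝ᵥ z) / n ≤ 1) :
    sketchLaw m n {Φ | 4 * (m : ℝ) ≤ (Matrix.of Φ *ᵥ z) ⬝ᵥ (Matrix.of Φ *ᵥ z)} ≤
      ENNReal.ofReal (Real.exp (-(m / 2))) := by
  have hc : 1 / 4 * ((z ⬝ᵥ z) / n) < 1 / 2 := by linarith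
  have h := (lintegral_exp_mulVec_sketchLaw (m := m) z hc).le
  refine (measure_le_of_exp_moment (sketchLaw m n) (t := m)
    ((continuous_mulVec_sketch z).measurable.const_mul (1 / 4)) ?_ h).trans ?_
  · intro Φ hΦ
    change 4 * (m : ℝ) ≤ _ at hΦ
    linarith
  · refine ENNReal.ofReal_le_ofReal ?_
    have h1 : 1 / Real.sqrt (1 - 2 * (1 / 4 * ((z ⬝ᵥ z) / n))) ≤ Real.exp (1 / 2) := by
      refine le_trans ?_ sqrt_two_le_exp_half
      rw [one_div, ← Real.sqrt_inv]
      refine Real.sqrt_le_sqrt ?_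
      rw [inv_le_comm₀ (by linarith) (by norm_num)]
      linarith
    calc _ ≤ Real.exp (1 / 2) ^ m * Real.exp (-m) := by gcongr
      _ = Real.exp (-(m / 2)) := by
        rw [← Real.exp_nat_mul, ← Real.exp_add]; congr 1; ring

/-- Chernoff at parameter `-4 / v`: the moment is exactly `3 ^ (-m) ≤ exp (-m)`, against a loss `exp
(m / 2)`. -/
lemma sketchLaw_lower {m n : ℕ} (z : Fin n → ℝ) (hz : 0 < (z ⬝ᵥ z) / n) :
    sketchLaw m n {Φ | (Matrix.of Φ *ᵥ z) ⬝ᵥ (Matrix.of Φ *ᵥ z) ≤ m * ((z ⬝ᵥ z) / n) / 8} ≤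
      ENNReal.ofReal (Real.exp (-(m / 2))) := by
  set v := (z ⬝ᵥ z) / n with hv
  have hcv : -(4 / v) * v = -4 := by field_simp
  have hc : -(4 / v) * v < 1 / 2 := by rw [hcv]; norm_num
  have h := (lintegral_exp_mulVec_sketchLaw (m := m) z hc).le
  refine (measure_le_of_exp_moment (sketchLaw m n) (t := -(m / 2))
    ((continuous_mulVec_sketch z).measurable.const_mul (-(4 / v))) ?_ h).trans ?_
  · intro Φ hΦ
    change _ ≤ m * v / 8 at hΦ
    have h4 : 0 ≤ 4 / v := by positivity
    have := mul_le_mul_of_nonneg_left hΦ h4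
    have h5 : 4 / v * (m * v / 8) = m / 2 := by field_simp; ring
    linarith
  · refine ENNReal.ofReal_le_ofReal ?_
    have h1 : 1 / Real.sqrt (1 - 2 * (-(4 / v) * v)) ≤ Real.exp (-1) := by
      rw [hcv, Real.exp_neg, ← one_div]
      have : Real.sqrt (1 - 2 * -4) = 3 := by
        rw [Real.sqrt_eq_iff_mul_self_eq] <;> norm_num
      rw [this]
      have := Real.exp_one_lt_d9
      exact one_div_le_one_div_of_le (Real.exp_pos _) (by linarith)
    calc _ ≤ Real.exp (-1) ^ m * Real.exp (-(-(m / 2))) := by gcongr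
      _ = Real.exp (-(m / 2)) := by
        rw [← Real.exp_nat_mul, ← Real.exp_add]; congr 1; ring

lemma sketchLaw_col_le {m n p : ℕ} (X : Matrix (Fin n) (Fin p) ℝ) (hX : ∀ i j, |X i j| ≤ 1) :
    sketchLaw m n {Φ | ¬ ∀ j, l2norm (fun i => (Matrix.of Φ * X) i j) ≤ 2 * Real.sqrt m} ≤
      ENNReal.ofReal (p * Real.exp (-(m / 2))) := by
  have hsub : {Φ : Fin m → Fin n → ℝ |
      ¬ ∀ j, l2norm (fun i => (Matrix.of Φ * X) i j) ≤ 2 * Real.sqrt m} ⊆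
      ⋃ j ∈ (Finset.univ : Finset (Fin p)), {Φ | 4 * (m : ℝ) ≤
        (Matrix.of Φ *ᵥ fun i => X i j) ⬝ᵥ (Matrix.of Φ *ᵥ fun i => X i j)} := by
    intro Φ hΦ
    simp only [Set.mem_ofPred_eq, not_forall, not_le] at hΦ
    obtain ⟨j, hj⟩ := hΦ
    simp only [Set.mem_iUnion]
    refine ⟨j, Finset.mem_univ j, ?_⟩
    change 4 * (m : ℝ) ≤ _
    have h1 := pow_le_pow_left₀ (by positivity) hj.le 2
    rw [l2norm_sq, mul_pow, Real.sq_sqrt (Nat.cast_nonneg _)] at h1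
    calc 4 * (m : ℝ) = 2 ^ 2 * m := by norm_num
      _ ≤ _ := h1
  refine (measure_mono hsub).trans ((measure_biUnion_finset_le _ _).trans ?_)
  refine (Finset.sum_le_sum fun j _ => sketchLaw_upper (fun i => X i j) ?_).trans ?_
  · refine div_le_one_of_le₀ ?_ (Nat.cast_nonneg _)
    calc (fun i => X i j) ⬝ᵥ (fun i => X i j) ≤ ∑ _i : Fin n, (1 : ℝ) := by
          refine Finset.sum_le_sum fun i _ => ?_
          have := hX i j
          rw [← abs_mul_abs_self]
          nlinarith [abs_nonneg (X i j)]
      _ = n := by simp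
  · rw [Finset.sum_const, Finset.card_univ, Fintype.card_fin, nsmul_eq_mul,
      ENNReal.ofReal_mul (Nat.cast_nonneg _), ENNReal.ofReal_natCast]

/-- Lower bound for the restricted singular values of the sketched design on a given support. -/
lemma sketchLaw_restricted_le {m n : ℕ} {ι : Type*} [Fintype ι] [Nonempty ι]
    (Y : Matrix (Fin n) ι ℝ) {η : ℝ} (hη : 0 < η) (hη1 : η ≤ 1)
    (hY : ∀ w : ι → ℝ, η * (w ⬝ᵥ w) ≤ (Y *ᵥ w) ⬝ᵥ (Y *ᵥ w) / n) :
    sketchLaw m n {Φ | (∀ j, l2norm (fun i => (Matrix.of Φ * Y) i j) ≤ 2 * Real.sqrt m) ∧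
        ∃ w : ι → ℝ, ((Matrix.of Φ * Y) *ᵥ w) ⬝ᵥ ((Matrix.of Φ * Y) *ᵥ w) <
          η / 256 * m * (w ⬝ᵥ w)} ≤
      ENNReal.ofReal ((48 * Fintype.card ι / Real.sqrt η) ^ Fintype.card ι *
        Real.exp (-(m / 2))) := by
  set D := Fintype.card ι with hD
  have hD1 : (1 : ℝ) ≤ D := by exact_mod_cast Fintype.card_pos
  set q := Real.sqrt η with hq
  have hq0 : 0 < q := Real.sqrt_pos.2 hη
  have hq1 : q ≤ 1 := Real.sqrt_le_one.2 hη1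
  have hqq : q ^ 2 = η := Real.sq_sqrt hη.le
  -- A volume argument replaces a net. One bad vector, scaled to sup norm one, makes a whole cube of
  -- half-side `ρ` nearly bad: moving within it changes `v` by at most `q / 32` in `l¹`, hence `Z v`
  -- by at most `q √m / 16`. Fubini bounds the expected volume of nearly bad vectors, and Markov's
  -- inequality bounds the probability that this volume reaches `(2 ρ) ^ D`.
  set ρ : ℝ := q / (32 * D) with hρ
  have hρ0 : 0 < ρ := by positivity
  have hρD : D * ρ = q / 32 := by rw [hρ]; field_simp
  have hρ1 : ρ ≤ 1 / 2 := by nlinarith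
  have hcoord : ∀ (w : ι → ℝ) (r : ℝ), ‖w‖ ≤ r → ∑ j, |w j| ≤ D * r := by
    intro w r hw
    refine (Finset.sum_le_sum fun j _ => (norm_le_pi_norm w j).trans hw).trans ?_
    simp [hD]
  have hsup : ∀ w : ι → ℝ, ‖w‖ ≤ l2norm w := by
    intro w
    refine (pi_norm_le_iff_of_nonneg (l2norm_nonneg w)).2 fun j => ?_
    exact PiLp.norm_apply_le (WithLp.toLp 2 w : EuclideanSpace ℝ ι) j
  let T : Set (ι → ℝ) := {w | 1 / 2 ≤ ‖w‖ ∧ ‖w‖ ≤ 3 / 2}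
  let F : Set ((Fin m → Fin n → ℝ) × (ι → ℝ)) := {x | x.2 ∈ T ∧
    (Matrix.of x.1 *ᵥ (Y *ᵥ x.2)) ⬝ᵥ (Matrix.of x.1 *ᵥ (Y *ᵥ x.2)) ≤
      m * ((Y *ᵥ x.2) ⬝ᵥ (Y *ᵥ x.2) / n) / 8}
  have hF : MeasurableSet F := by
    refine IsClosed.measurableSet ?_
    have h1 : IsClosed {x : (Fin m → Fin n → ℝ) × (ι → ℝ) | 1 / 2 ≤ ‖x.2‖} :=
      isClosed_le continuous_const (continuous_norm.comp continuous_snd)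
    have h2 : IsClosed {x : (Fin m → Fin n → ℝ) × (ι → ℝ) | ‖x.2‖ ≤ 3 / 2} :=
      isClosed_le (continuous_norm.comp continuous_snd) continuous_const
    have h3 : IsClosed {x : (Fin m → Fin n → ℝ) × (ι → ℝ) |
        (Matrix.of x.1 *ᵥ (Y *ᵥ x.2)) ⬝ᵥ (Matrix.of x.1 *ᵥ (Y *ᵥ x.2)) ≤
          m * ((Y *ᵥ x.2) ⬝ᵥ (Y *ᵥ x.2) / n) / 8} := by
      refine isClosed_le ?_ ?_
      · simp only [dotProduct, Matrix.mulVec, Matrix.of_apply]; fun_prop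
      · simp only [dotProduct, Matrix.mulVec]; fun_prop
    exact (h1.inter h2).inter h3
  have hcube : ∀ Φ : Fin m → Fin n → ℝ,
      ((∀ j, l2norm (fun i => (Matrix.of Φ * Y) i j) ≤ 2 * Real.sqrt m) ∧
        ∃ w : ι → ℝ, ((Matrix.of Φ * Y) *ᵥ w) ⬝ᵥ ((Matrix.of Φ * Y) *ᵥ w) <
          η / 256 * m * (w ⬝ᵥ w)) →
      ENNReal.ofReal ((2 * ρ) ^ D) ≤ volume (Prod.mk Φ ⁻¹' F) := by
    rintro Φ ⟨hcol, v₀, hv₀⟩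
    have hv₀0 : v₀ ≠ 0 := by rintro rfl; simp at hv₀
    have hn0 : 0 < ‖v₀‖ := norm_pos_iff.2 hv₀0
    set v : ι → ℝ := ‖v₀‖⁻¹ • v₀ with hv
    have hv1 : ‖v‖ = 1 := by rw [hv, norm_smul, norm_inv, norm_norm, inv_mul_cancel₀ hn0.ne']
    set Z := Matrix.of Φ * Y with hZ
    have hZv : l2norm (Z *ᵥ v) ≤ q / 16 * Real.sqrt m * l2norm v := by
      refine le_of_sq_le_sq ?_ (by have := l2norm_nonneg v; positivity)
      rw [l2norm_sq, mul_pow, mul_pow, l2norm_sq v, div_pow, hqq, Real.sq_sqrt (Nat.cast_nonneg _),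
        hv, Matrix.mulVec_smul]
      simp only [smul_dotProduct, dotProduct_smul, smul_eq_mul]
      have h1 := mul_le_mul_of_nonneg_left hv₀.le (mul_self_nonneg ‖v₀‖⁻¹)
      linarith
    rw [← Real.volume_pi_closedBall v hρ0.le]
    refine measure_mono fun w hw => ?_
    rw [Metric.mem_closedBall, dist_eq_norm] at hw
    have hw1 : 1 / 2 ≤ ‖w‖ := by
      have h1 : ‖v‖ ≤ ‖w - v‖ + ‖w‖ := by
        rw [norm_sub_rev]; simpa using norm_add_le (v - w) w
      linarith
    have hw2 : ‖w‖ ≤ 3 / 2 := by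
      have h1 : ‖w‖ ≤ ‖w - v‖ + ‖v‖ := by simpa using norm_add_le (w - v) v
      linarith
    refine ⟨⟨hw1, hw2⟩, ?_⟩
    change (Matrix.of Φ *ᵥ (Y *ᵥ w)) ⬝ᵥ (Matrix.of Φ *ᵥ (Y *ᵥ w)) ≤
      m * ((Y *ᵥ w) ⬝ᵥ (Y *ᵥ w) / n) / 8
    rw [Matrix.mulVec_mulVec, ← hZ, ← l2norm_sq]
    have hdiff := hcoord _ _ hw
    rw [hρD] at hdiff
    have h1 : l2norm (Z *ᵥ w) ≤ l2norm (Z *ᵥ v) + 2 * Real.sqrt m * (q / 32) := by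
      calc l2norm (Z *ᵥ w) = l2norm (Z *ᵥ v + Z *ᵥ (w - v)) := by
            rw [← Matrix.mulVec_add, add_sub_cancel]
        _ ≤ l2norm (Z *ᵥ v) + l2norm (Z *ᵥ (w - v)) := l2norm_add_le _ _
        _ ≤ _ := by
            refine add_le_add_right ((l2norm_mulVec_le hcol _).trans ?_) _
            exact mul_le_mul_of_nonneg_left hdiff (by positivity)
    have h2 : l2norm v ≤ l2norm w + q / 32 := by
      calc l2norm v = l2norm (w + (v - w)) := by rw [add_sub_cancel]
        _ ≤ l2norm w + l2norm (v - w) := l2norm_add_le _ _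
        _ ≤ _ := by
            rw [l2norm_sub_comm]
            exact add_le_add_right ((l2norm_le_sum_abs _).trans hdiff) _
    have h3 : 1 / 2 ≤ l2norm w := hw1.trans (hsup w)
    have h4 : l2norm (Z *ᵥ w) ≤ q / 4 * Real.sqrt m * l2norm w := by
      have h5 : l2norm v ≤ 2 * l2norm w := by linarith
      have h6 : q / 16 * Real.sqrt m * l2norm v ≤ q / 16 * Real.sqrt m * (2 * l2norm w) :=
        mul_le_mul_of_nonneg_left h5 (by positivity)
      have h7 : 2 * Real.sqrt m * (q / 32) * 1 ≤ 2 * Real.sqrt m * (q / 32) * (2 * l2norm w) :=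
        mul_le_mul_of_nonneg_left (by linarith) (by positivity)
      linarith
    calc l2norm (Z *ᵥ w) ^ 2 ≤ (q / 4 * Real.sqrt m * l2norm w) ^ 2 :=
          pow_le_pow_left₀ (l2norm_nonneg _) h4 2
      _ = m * (η * (w ⬝ᵥ w)) / 16 := by
          rw [mul_pow, mul_pow, Real.sq_sqrt (Nat.cast_nonneg _), l2norm_sq, div_pow, hqq]; ring
      _ ≤ m * (η * (w ⬝ᵥ w)) / 8 := by
          have : 0 ≤ m * (η * (w ⬝ᵥ w)) := by
            have := dotProduct_self_nonneg_real w
            positivity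
          linarith
      _ ≤ m * ((Y *ᵥ w) ⬝ᵥ (Y *ᵥ w) / n) / 8 := by
          have := mul_le_mul_of_nonneg_left (hY w) (Nat.cast_nonneg (α := ℝ) m)
          linarith
  have hslice : ∀ w : ι → ℝ, sketchLaw m n ((fun Φ => (Φ, w)) ⁻¹' F) ≤
      (Metric.closedBall (0 : ι → ℝ) (3 / 2)).indicator
        (fun _ => ENNReal.ofReal (Real.exp (-(m / 2)))) w := by
    intro w
    by_cases hw : w ∈ T
    · have hw0 : 0 < l2norm w := by
        have := hw.1.trans (hsup w); linarith
      have hpos : 0 < (Y *ᵥ w) ⬝ᵥ (Y *ᵥ w) / n := by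
        refine lt_of_lt_of_le ?_ (hY w)
        rw [← l2norm_sq]; positivity
      rw [Set.indicator_of_mem (by simpa using hw.2)]
      exact (measure_mono fun Φ hΦ => hΦ.2).trans (sketchLaw_lower (Y *ᵥ w) hpos)
    · have : (fun Φ : Fin m → Fin n → ℝ => (Φ, w)) ⁻¹' F = ∅ := by
        ext Φ; simp only [Set.mem_preimage, Set.mem_empty_iff_false, iff_false]
        exact fun h => hw h.1
      rw [this, measure_empty]; exact zero_le
  have hfub : ∫⁻ Φ, volume (Prod.mk Φ ⁻¹' F) ∂(sketchLaw m n) ≤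
      ENNReal.ofReal (3 ^ D * Real.exp (-(m / 2))) := by
    rw [← Measure.prod_apply hF, Measure.prod_apply_symm hF]
    refine (lintegral_mono hslice).trans ?_
    rw [lintegral_indicator_const Metric.isClosed_closedBall.measurableSet,
      Real.volume_pi_closedBall _ (by norm_num), ← ENNReal.ofReal_mul (Real.exp_pos _).le]
    refine ENNReal.ofReal_le_ofReal (le_of_eq ?_)
    norm_num [hD]; ring
  -- The ratio of the volumes `3 ^ D` (ball of radius `3/2`) and `(2 ρ) ^ D` is the factor `(48 D /
  -- q) ^ D`.
  have hmarkov := mul_meas_ge_le_lintegral (μ := sketchLaw m n)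
    (measurable_measure_prodMk_left (ν := (volume : Measure (ι → ℝ))) hF)
    (ENNReal.ofReal ((2 * ρ) ^ D))
  have h2ρ : 0 < (2 * ρ) ^ D := by positivity
  have hfinal := (mul_le_mul_right (measure_mono (μ := sketchLaw m n) hcube)
    (ENNReal.ofReal ((2 * ρ) ^ D))).trans (hmarkov.trans hfub)
  have heq : ENNReal.ofReal (3 ^ D * Real.exp (-(m / 2))) = ENNReal.ofReal ((2 * ρ) ^ D) *
      ENNReal.ofReal ((48 * D / q) ^ D * Real.exp (-(m / 2))) := by
    rw [← ENNReal.ofReal_mul h2ρ.le, ← mul_assoc, ← mul_pow]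
    congr 3
    rw [hρ]; field_simp; norm_num
  rw [heq] at hfinal
  exact (ENNReal.mul_le_mul_iff_right (ENNReal.ofReal_pos.2 h2ρ).ne' ENNReal.ofReal_ne_top).1 hfinal

/-- A union bound over supports. Giving up one more factor `p` per index (`p²` instead of `p`)
leaves weights `p ^ (-|S|)`, whose sum over all `S` is `(1 + 1/p) ^ p ≤ e`. -/
lemma sketchLaw_restrictedEigenvalue_le {m n p : ℕ} (X : Matrix (Fin n) (Fin p) ℝ)
    {ξ₀ : Finset (Fin p)} (hξ₀ : ξ₀.Nonempty) {k : ℕ} {η : ℝ} (hη : 0 < η) (hη1 : η ≤ 1)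
    (hX : ∀ ξ : Finset (Fin p), ξ₀ ⊆ ξ → ξ.card ≤ k → ∀ e ∈ spectrum ℝ (gram X ξ), η ≤ e) :
    sketchLaw m n {Φ | (∀ j, l2norm (fun i => (Matrix.of Φ * X) i j) ≤ 2 * Real.sqrt m) ∧
        ¬ ∀ S : Finset (Fin p), ξ₀ ⊆ S → S.card ≤ k → ∀ v : Fin p → ℝ, (∀ j ∉ S, v j = 0) →
          η / 256 * m * (v ⬝ᵥ v) ≤
            ((Matrix.of Φ * X) *ᵥ v) ⬝ᵥ ((Matrix.of Φ * X) *ᵥ v)} ≤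
      ENNReal.ofReal ((48 * p ^ 2 / Real.sqrt η) ^ k * Real.exp 1 * Real.exp (-(m / 2))) := by
  classical
  have hp0 : 0 < p := by
    obtain ⟨j, -⟩ := hξ₀
    exact j.pos
  have hp1 : (1 : ℝ) ≤ p := by exact_mod_cast hp0
  have hq0 : 0 < Real.sqrt η := Real.sqrt_pos.2 hη
  have hq1 : Real.sqrt η ≤ 1 := Real.sqrt_le_one.2 hη1
  let XS : (S : Finset (Fin p)) → Matrix (Fin n) S ℝ := fun S => X.submatrix id (fun j : S => (j : Fin p))
  let Bad : Finset (Fin p) → Set (Fin m → Fin n → ℝ) := fun S =>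
    {Φ | (∀ j, l2norm (fun i => (Matrix.of Φ * XS S) i j) ≤ 2 * Real.sqrt m) ∧
        ∃ w : S → ℝ, ((Matrix.of Φ * XS S) *ᵥ w) ⬝ᵥ ((Matrix.of Φ * XS S) *ᵥ w) <
          η / 256 * m * (w ⬝ᵥ w)}
  let I : Finset (Finset (Fin p)) := Finset.univ.filter fun S => ξ₀ ⊆ S ∧ S.card ≤ k
  have hsub : {Φ : Fin m → Fin n → ℝ |
      (∀ j, l2norm (fun i => (Matrix.of Φ * X) i j) ≤ 2 * Real.sqrt m) ∧
        ¬ ∀ S : Finset (Fin p), ξ₀ ⊆ S → S.card ≤ k → ∀ v : Fin p → ℝ, (∀ j ∉ S, v j = 0) →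
          η / 256 * m * (v ⬝ᵥ v) ≤
            ((Matrix.of Φ * X) *ᵥ v) ⬝ᵥ ((Matrix.of Φ * X) *ᵥ v)} ⊆ ⋃ S ∈ I, Bad S := by
    rintro Φ ⟨hcol, hne⟩
    simp only [not_forall, not_le] at hne
    obtain ⟨S, hS, hSk, v, hv, hlt⟩ := hne
    simp only [Set.mem_iUnion]
    refine ⟨S, by simp [I, hS, hSk], fun j => hcol j, fun j => v j, ?_⟩
    have h1 : XS S *ᵥ (fun j : S => v j) = X *ᵥ v := by
      ext i
      simp only [XS, Matrix.mulVec, dotProduct, Matrix.submatrix_apply, id]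
      rw [Finset.sum_coe_sort S fun j => X i j * v j]
      exact Finset.sum_subset (Finset.subset_univ S) fun j _ hj => by simp [hv j hj]
    have h2 : (fun j : S => v j) ⬝ᵥ (fun j : S => v j) = v ⬝ᵥ v := by
      simp only [dotProduct]
      rw [Finset.sum_coe_sort S fun j => v j * v j]
      exact Finset.sum_subset (Finset.subset_univ S) fun j _ hj => by simp [hv j hj]
    rw [← Matrix.mulVec_mulVec, h1, h2, Matrix.mulVec_mulVec]
    exact hlt
  have hbad : ∀ S ∈ I, sketchLaw m n (Bad S) ≤ ENNReal.ofReal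
      ((48 * p ^ 2 / Real.sqrt η) ^ k * Real.exp (-(m / 2)) * (1 / p : ℝ) ^ S.card) := by
    intro S hS
    obtain ⟨hS0, hSk⟩ : ξ₀ ⊆ S ∧ S.card ≤ k := by simpa [I] using hS
    have : Nonempty S := (hξ₀.mono hS0).to_subtype
    refine (sketchLaw_restricted_le (XS S) hη hη1
      (le_dotProduct_of_spectrum_gram X S (hX S hS0 hSk))).trans (ENNReal.ofReal_le_ofReal ?_)
    rw [Fintype.card_coe, mul_right_comm]
    refine mul_le_mul_of_nonneg_right ?_ (Real.exp_pos _).le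
    have hSp : (S.card : ℝ) ≤ p := by
      have := Finset.card_le_univ S
      rw [Fintype.card_fin] at this
      exact_mod_cast this
    calc (48 * (S.card : ℝ) / Real.sqrt η) ^ S.card ≤ (48 * p / Real.sqrt η) ^ S.card := by gcongr
      _ = (48 * p ^ 2 / Real.sqrt η) ^ S.card * (1 / p : ℝ) ^ S.card := by
          rw [← mul_pow]; congr 1; field_simp
      _ ≤ (48 * p ^ 2 / Real.sqrt η) ^ k * (1 / p : ℝ) ^ S.card := by
          refine mul_le_mul_of_nonneg_right (pow_le_pow_right₀ ?_ hSk) (by positivity)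
          rw [one_le_div hq0]
          nlinarith
  refine (measure_mono hsub).trans ((measure_biUnion_finset_le _ _).trans ?_)
  refine (Finset.sum_le_sum hbad).trans ?_
  rw [← ENNReal.ofReal_sum_of_nonneg]
  swap
  · intro S _; positivity
  refine ENNReal.ofReal_le_ofReal ?_
  rw [← Finset.mul_sum, mul_right_comm _ (Real.exp 1)]
  refine mul_le_mul_of_nonneg_left ?_ (by positivity)
  calc ∑ S ∈ I, (1 / p : ℝ) ^ S.card ≤ ∑ S : Finset (Fin p), (1 / p : ℝ) ^ S.card :=
        Finset.sum_le_sum_of_subset_of_nonneg (Finset.subset_univ I) fun S _ _ => by positivity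
    _ = (1 + 1 / p : ℝ) ^ p := sum_finset_pow_card p _
    _ ≤ Real.exp (1 / p) ^ p := by
        gcongr
        rw [add_comm]; exact Real.add_one_le_exp _
    _ = Real.exp 1 := by rw [← Real.exp_nat_mul]; congr 1; field_simp

/-! ### The prior -/

lemma lintegral_ofReal_inv_mul_comp_div {μ : ℝ} (hμ : 0 < μ) {g : ℝ → ℝ≥0∞} (hg : Measurable g) :
    ∫⁻ x, ENNReal.ofReal μ⁻¹ * g (x / μ) = ∫⁻ y, g y := by
  have h := Real.map_volume_mul_left (a := μ⁻¹) (inv_ne_zero hμ.ne')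
  rw [inv_inv, abs_of_pos hμ] at h
  rw [lintegral_const_mul' _ _ ENNReal.ofReal_ne_top]
  have h1 : ∫⁻ x, g (x / μ) = ∫⁻ y, g y ∂(volume.map (μ⁻¹ * ·)) := by
    rw [lintegral_map hg (by fun_prop)]
    exact lintegral_congr fun x => by rw [div_eq_inv_mul]
  rw [h1, h, lintegral_smul_measure, smul_eq_mul, ← mul_assoc,
    ← ENNReal.ofReal_mul (inv_nonneg.2 hμ.le), inv_mul_cancel₀ hμ.ne', ENNReal.ofReal_one, one_mul]

/-- The prior law of one coordinate. -/
def coordLaw (h : ℝ → ℝ≥0∞) (μ : ℝ) : Measure ℝ := volume.withDensity (scaledDensity h μ)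

lemma isProbabilityMeasure_coordLaw {h : ℝ → ℝ≥0∞} {r μ : ℝ} (hh : IsPolyTailDensity h r)
    (hμ : 0 < μ) : IsProbabilityMeasure (coordLaw h μ) := by
  refine ⟨?_⟩
  rw [coordLaw, withDensity_apply _ MeasurableSet.univ, Measure.restrict_univ]
  unfold scaledDensity
  rw [lintegral_ofReal_inv_mul_comp_div hμ hh.measurable, hh.lintegral_eq_one]

lemma lintegral_rpow_tail_le {c r t : ℝ} (hc : 0 ≤ c) (hr : 1 < r) (ht : 0 < t) :
    ∫⁻ y in {y : ℝ | t ≤ |y|}, ENNReal.ofReal (c * |y| ^ (-r)) ≤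
      ENNReal.ofReal (2 * c / (r - 1) * t ^ (1 - r)) := by
  have hpos : ∫⁻ y in Set.Ici t, ENNReal.ofReal (c * |y| ^ (-r)) =
      ENNReal.ofReal (c / (r - 1) * t ^ (1 - r)) := by
    rw [← setLIntegral_congr (Ioi_ae_eq_Ici (a := t) (μ := volume))]
    have h1 : ∫⁻ y in Set.Ioi t, ENNReal.ofReal (c * |y| ^ (-r)) =
        ∫⁻ y in Set.Ioi t, ENNReal.ofReal (c * y ^ (-r)) := by
      refine setLIntegral_congr_fun measurableSet_Ioi fun y hy => ?_
      rw [abs_of_pos (ht.trans hy)]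
    rw [h1, ← ofReal_integral_eq_lintegral_ofReal
      ((integrableOn_Ioi_rpow_of_lt (by linarith) ht).const_mul c)
      ((ae_restrict_iff' measurableSet_Ioi).2 (ae_of_all _ fun y hy => mul_nonneg hc
        (Real.rpow_nonneg (ht.trans hy).le _))), integral_const_mul,
      integral_Ioi_rpow_of_lt (by linarith) ht]
    congr 1
    rw [show -r + 1 = -(r - 1) by ring, show 1 - r = -(r - 1) by ring]
    have : r - 1 ≠ 0 := by linarith
    field_simp
  have hneg : ∫⁻ y in Set.Iic (-t), ENNReal.ofReal (c * |y| ^ (-r)) =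
      ∫⁻ y in Set.Ici t, ENNReal.ofReal (c * |y| ^ (-r)) := by
    have := (Measure.measurePreserving_neg (volume : Measure ℝ)).setLIntegral_comp_preimage
      (s := Set.Iic (-t)) measurableSet_Iic (f := fun y => ENNReal.ofReal (c * |y| ^ (-r)))
      (by fun_prop)
    rw [← this]
    simp
  have hsub : {y : ℝ | t ≤ |y|} ⊆ Set.Ici t ∪ Set.Iic (-t) := by
    intro y hy
    rcases le_abs.1 (show t ≤ |y| from hy) with h | h
    · exact Or.inl h
    · exact Or.inr (by simp only [Set.mem_Iic]; linarith)
  refine (lintegral_mono_set hsub).trans ((lintegral_union_le _ _ _).trans (le_of_eq ?_))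
  rw [hneg, hpos, ← ENNReal.ofReal_add] <;> try (have : 0 < r - 1 := by linarith); positivity
  congr 1; ring

lemma IsPolyTailDensity.exists_coordLaw_tail_le {h : ℝ → ℝ≥0∞} {r : ℝ} (hh : IsPolyTailDensity h r)
    (hr : 1 < r) : ∃ C R : ℝ, 0 < C ∧ ∀ μ a : ℝ, 0 < μ → 0 < a → R ≤ a / μ →
      coordLaw h μ {x | a ≤ |x|} ≤ ENNReal.ofReal (C * (a / μ) ^ (1 - r)) := by
  obtain ⟨c₁, c₂, R, hc₁, hc₂, htail⟩ := hh.tail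
  refine ⟨2 * c₂ / (r - 1), R, div_pos (by linarith) (by linarith), fun μ a hμ ha haR => ?_⟩
  have hmeas : ∀ t : ℝ, MeasurableSet {x : ℝ | t ≤ |x|} := fun t =>
    measurableSet_le measurable_const measurable_norm
  refine le_trans ?_ (lintegral_rpow_tail_le hc₂.le hr (div_pos ha hμ))
  have h1 : coordLaw h μ {x | a ≤ |x|} = ∫⁻ y in {y : ℝ | a / μ ≤ |y|}, h y := by
    rw [coordLaw, withDensity_apply _ (hmeas a), ← lintegral_indicator (hmeas a),
      ← lintegral_indicator (hmeas _), ← lintegral_ofReal_inv_mul_comp_div hμ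
        (hh.measurable.indicator (hmeas _))]
    refine lintegral_congr fun x => ?_
    have : x ∈ {x : ℝ | a ≤ |x|} ↔ x / μ ∈ {y : ℝ | a / μ ≤ |y|} := by
      simp only [Set.mem_ofPred_eq]
      rw [abs_div, abs_of_pos hμ, div_le_div_iff_of_pos_right hμ]
    by_cases hx : x ∈ {x : ℝ | a ≤ |x|}
    · rw [Set.indicator_of_mem hx, Set.indicator_of_mem (this.1 hx)]; rfl
    · rw [Set.indicator_of_notMem hx, Set.indicator_of_notMem fun h' => hx (this.2 h'), mul_zero]
  rw [h1]
  exact setLIntegral_mono' (hmeas _) fun y hy => (htail y (haR.trans hy)).2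

/-- The density is controlled only far from zero, so the mass is taken from a piece `J` of length `a
/ 2` on the side of `b` away from the origin. There `a / 2 ≤ |x|`, which explains the `2 * R`, while
`1 ≤ a / μ` absorbs the scaling factor. -/
lemma IsPolyTailDensity.exists_le_coordLaw {h : ℝ → ℝ≥0∞} {r : ℝ} (hh : IsPolyTailDensity h r)
    (hr : 1 < r) : ∃ c R : ℝ, 0 < c ∧ ∀ μ a b N : ℝ, 0 < μ → 0 < a → R ≤ a / μ →
      (|b| + a) / μ ≤ N → ENNReal.ofReal (c * N ^ (-r)) ≤ coordLaw h μ {x | |x - b| ≤ a} := by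
  obtain ⟨c₁, c₂, R, hc₁, hc₂, htail⟩ := hh.tail
  refine ⟨c₁ / 2, max 1 (2 * R), by positivity, fun μ a b N hμ ha haR hN => ?_⟩
  have h1 : 1 ≤ a / μ := (le_max_left _ _).trans haR
  have h2 : 2 * R ≤ a / μ := (le_max_right _ _).trans haR
  obtain ⟨J, hJm, hJv, hJb, hJl, hJu⟩ : ∃ J : Set ℝ, MeasurableSet J ∧
      volume J = ENNReal.ofReal (a / 2) ∧ J ⊆ {x | |x - b| ≤ a} ∧ (∀ x ∈ J, a / 2 ≤ |x|) ∧
      ∀ x ∈ J, |x| ≤ |b| + a := by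
    rcases le_total 0 b with hb | hb
    · refine ⟨Set.Icc (b + a / 2) (b + a), measurableSet_Icc, ?_, ?_, ?_, ?_⟩
      · rw [Real.volume_Icc]; congr 1; ring
      · intro x hx; change |x - b| ≤ a; rw [abs_le]; constructor <;> linarith [hx.1, hx.2]
      · intro x hx; exact le_trans (by linarith [hx.1]) (le_abs_self x)
      · intro x hx; rw [abs_of_nonneg hb, abs_le]; constructor <;> linarith [hx.1, hx.2]
    · refine ⟨Set.Icc (b - a) (b - a / 2), measurableSet_Icc, ?_, ?_, ?_, ?_⟩
      · rw [Real.volume_Icc]; congr 1; ring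
      · intro x hx; change |x - b| ≤ a; rw [abs_le]; constructor <;> linarith [hx.1, hx.2]
      · intro x hx; exact le_trans (by linarith [hx.2]) (neg_le_abs x)
      · intro x hx; rw [abs_of_nonpos hb, abs_le]; constructor <;> linarith [hx.1, hx.2]
  have hNpos : 0 < N := lt_of_lt_of_le (by positivity) hN
  refine le_trans ?_ (measure_mono hJb)
  rw [coordLaw, withDensity_apply _ hJm]
  calc ENNReal.ofReal (c₁ / 2 * N ^ (-r)) ≤
        ENNReal.ofReal (μ⁻¹ * (c₁ * N ^ (-r))) * volume J := by
        rw [hJv, ← ENNReal.ofReal_mul (by positivity)]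
        refine ENNReal.ofReal_le_ofReal ?_
        have h3 : μ⁻¹ * (c₁ * N ^ (-r)) * (a / 2) = c₁ / 2 * N ^ (-r) * (a / μ) := by
          field_simp
        rw [h3]
        exact le_mul_of_one_le_right (by positivity) h1
    _ = ∫⁻ _ in J, ENNReal.ofReal (μ⁻¹ * (c₁ * N ^ (-r))) := by rw [setLIntegral_const]
    _ ≤ ∫⁻ x in J, scaledDensity h μ x := by
        refine setLIntegral_mono' hJm fun x hx => ?_
        have h4 : |x / μ| = |x| / μ := by rw [abs_div, abs_of_pos hμ]
        have h5 : a / 2 / μ ≤ |x / μ| := by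
          rw [h4]; exact div_le_div_of_nonneg_right (hJl x hx) hμ.le
        have h6 : R ≤ |x / μ| := by
          have : a / 2 / μ = a / μ / 2 := by ring
          linarith
        have h7 : |x / μ| ≤ N := by
          rw [h4]; exact (div_le_div_of_nonneg_right (hJu x hx) hμ.le).trans hN
        rw [scaledDensity, ENNReal.ofReal_mul (inv_nonneg.2 hμ.le)]
        refine mul_le_mul_right (le_trans (ENNReal.ofReal_le_ofReal ?_) (htail _ h6).1) _
        refine mul_le_mul_of_nonneg_left ?_ hc₁.le
        exact Real.rpow_le_rpow_of_nonpos (lt_of_lt_of_le (by positivity) h5) h7 (by linarith)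

lemma prior_eq (p : ℕ) (h : ℝ → ℝ≥0∞) (μ : ℝ) :
    prior p h μ = Measure.pi fun _ : Fin p => coordLaw h μ := rfl

/-- The coordinates are independent and each contributes at most `1 + C / p ≤ exp (C / p)`, so the
product over `p` of them stays bounded. -/
lemma lintegral_exp_numLarge_prior_le {p : ℕ} {h : ℝ → ℝ≥0∞} {μ : ℝ}
    [IsProbabilityMeasure (coordLaw h μ)] {a c C : ℝ} (hC : 0 ≤ C) (hp : 0 < p)
    (htail : coordLaw h μ {x | a ≤ |x|} ≤ ENNReal.ofReal (C / p * Real.exp (-c))) :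
    ∫⁻ β, ENNReal.ofReal (Real.exp (c * numLarge a β)) ∂(prior p h μ) ≤
      ENNReal.ofReal (Real.exp C) := by
  have hp' : (0 : ℝ) < p := by exact_mod_cast hp
  have hmeas : MeasurableSet {x : ℝ | a ≤ |x|} := measurableSet_le measurable_const measurable_norm
  simp_rw [ofReal_exp_mul_numLarge]
  rw [prior_eq, lintegral_pi_prod _ (fun _ x => if a ≤ |x| then ENNReal.ofReal (Real.exp c) else 1)
    (fun _ => measurable_ite_le_abs a _)]
  have h1 : ∫⁻ x, (if a ≤ |x| then ENNReal.ofReal (Real.exp c) else 1) ∂(coordLaw h μ) ≤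
      ENNReal.ofReal (Real.exp (C / p)) := by
    calc ∫⁻ x, (if a ≤ |x| then ENNReal.ofReal (Real.exp c) else 1) ∂(coordLaw h μ)
        ≤ ∫⁻ x, (1 + {x : ℝ | a ≤ |x|}.indicator (fun _ => ENNReal.ofReal (Real.exp c)) x)
            ∂(coordLaw h μ) := by
          refine lintegral_mono fun x => ?_
          by_cases hx : a ≤ |x|
          · rw [Set.indicator_of_mem (show x ∈ {x : ℝ | a ≤ |x|} from hx)]; simp [hx]
          · rw [Set.indicator_of_notMem (show x ∉ {x : ℝ | a ≤ |x|} from hx)]; simp [hx]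
      _ = 1 + ENNReal.ofReal (Real.exp c) * coordLaw h μ {x | a ≤ |x|} := by
          rw [lintegral_add_left measurable_const, lintegral_indicator_const hmeas]
          simp
      _ ≤ 1 + ENNReal.ofReal (Real.exp c) * ENNReal.ofReal (C / p * Real.exp (-c)) := by gcongr
      _ = ENNReal.ofReal (1 + C / p) := by
          rw [← ENNReal.ofReal_mul (Real.exp_pos _).le, ENNReal.ofReal_add zero_le_one (by positivity),
            ENNReal.ofReal_one, mul_left_comm, ← Real.exp_add]
          simp
      _ ≤ ENNReal.ofReal (Real.exp (C / p)) :=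
          ENNReal.ofReal_le_ofReal (by rw [add_comm]; exact Real.add_one_le_exp _)
  refine (Finset.prod_le_prod' fun _ _ => h1).trans (le_of_eq ?_)
  rw [Finset.prod_const, Finset.card_univ, Fintype.card_fin, ← ENNReal.ofReal_pow (Real.exp_pos _).le,
    ← Real.exp_nat_mul]
  congr 2
  field_simp

/-- Each active coordinate costs a factor `g`; all inactive ones together cost at most a factor two,
by Bernoulli's inequality for `(1 - 1 / (2 p)) ^ p`. -/
lemma le_prior_box {p : ℕ} {h : ℝ → ℝ≥0∞} {μ : ℝ} [IsProbabilityMeasure (coordLaw h μ)]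
    {βs : Fin p → ℝ} {a g : ℝ} (hg : 0 ≤ g) (hp : 0 < p)
    (htail : coordLaw h μ {x | a ≤ |x|} ≤ ENNReal.ofReal (1 / (2 * p)))
    (hactive : ∀ j ∈ activeSet βs, ENNReal.ofReal g ≤ coordLaw h μ {x | |x - βs j| ≤ a}) :
    ENNReal.ofReal (g ^ sparsity βs / 2) ≤ prior p h μ {β | ∀ j, |β j - βs j| ≤ a} := by
  classical
  have hp1 : (1 : ℝ) ≤ p := by exact_mod_cast hp
  have hq : 1 / (2 * p : ℝ) ≤ 1 / 2 := by
    rw [div_le_div_iff₀ (by positivity) (by norm_num)]; linarith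
  have hq0 : 0 ≤ 1 / (2 * p : ℝ) := by positivity
  have hset : {β : Fin p → ℝ | ∀ j, |β j - βs j| ≤ a} =
      Set.pi Set.univ fun j => {x | |x - βs j| ≤ a} := by
    ext; simp
  rw [hset, prior_eq, Measure.pi_pi]
  have hinactive : ∀ j ∉ activeSet βs,
      ENNReal.ofReal (1 - 1 / (2 * p)) ≤ coordLaw h μ {x | |x - βs j| ≤ a} := by
    intro j hj
    have hj0 : βs j = 0 := by simpa [activeSet] using hj
    have hmeas : MeasurableSet {x : ℝ | a ≤ |x|} :=
      measurableSet_le measurable_const measurable_norm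
    have hsub : {x : ℝ | a ≤ |x|}ᶜ ⊆ {x | |x - βs j| ≤ a} := by
      intro x hx
      simp only [Set.mem_compl_iff, Set.mem_ofPred_eq, not_le] at hx
      change |x - βs j| ≤ a
      rw [hj0, sub_zero]; exact hx.le
    refine le_trans ?_ (measure_mono hsub)
    rw [prob_compl_eq_one_sub hmeas, ENNReal.ofReal_sub _ hq0, ENNReal.ofReal_one]
    exact tsub_le_tsub_left htail 1
  calc ENNReal.ofReal (g ^ sparsity βs / 2)
      ≤ ∏ j, (if j ∈ activeSet βs then ENNReal.ofReal g else 1) *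
          ENNReal.ofReal (1 - 1 / (2 * p)) := by
        rw [Finset.prod_mul_distrib, Finset.prod_ite_mem, Finset.univ_inter, Finset.prod_const,
          Finset.prod_const, Finset.card_univ, Fintype.card_fin, ← ENNReal.ofReal_pow hg,
          ← ENNReal.ofReal_pow (by linarith), ← ENNReal.ofReal_mul (by positivity)]
        refine ENNReal.ofReal_le_ofReal ?_
        change g ^ sparsity βs / 2 ≤ g ^ sparsity βs * _
        rw [div_eq_mul_one_div]
        refine mul_le_mul_of_nonneg_left ?_ (by positivity)
        have h1 := one_add_mul_le_pow (a := -(1 / (2 * p : ℝ))) (by linarith) p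
        have h2 : 1 + (p : ℝ) * -(1 / (2 * p)) = 1 / 2 := by field_simp; norm_num
        rw [h2] at h1
        rw [sub_eq_add_neg]; exact h1
    _ ≤ ∏ j, coordLaw h μ {x | |x - βs j| ≤ a} := by
        refine Finset.prod_le_prod' fun j _ => ?_
        split_ifs with hj
        · refine le_trans ?_ (hactive j hj)
          refine (mul_le_mul_right (b := ENNReal.ofReal (1 - 1 / (2 * p))) (c := 1) ?_ _).trans
            (mul_one _).le
          rw [ENNReal.ofReal_le_one]; linarith
        · rw [one_mul]; exact hinactive j hj

/-! ### The horseshoe and the generalized double Pareto densities -/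

lemma setLIntegral_Iic_neg_comp_abs (f : ℝ → ℝ≥0∞) (hf : Measurable f) (t : ℝ) :
    ∫⁻ y in Set.Iic (-t), f |y| = ∫⁻ y in Set.Ici t, f |y| := by
  have := (Measure.measurePreserving_neg (volume : Measure ℝ)).setLIntegral_comp_preimage
    (s := Set.Iic (-t)) measurableSet_Iic (f := fun y => f |y|) (hf.comp measurable_norm)
  rw [← this]
  simp

lemma lintegral_comp_abs_eq (f : ℝ → ℝ≥0∞) (hf : Measurable f) :
    ∫⁻ x, f |x| = 2 * ∫⁻ x in Set.Ioi (0 : ℝ), f x := by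
  have h1 : ∫⁻ x in Set.Ioi (0 : ℝ), f |x| = ∫⁻ x in Set.Ioi (0 : ℝ), f x :=
    setLIntegral_congr_fun measurableSet_Ioi fun x hx => by rw [abs_of_pos hx]
  have h2 : ∫⁻ x in Set.Iic (0 : ℝ), f |x| = ∫⁻ x in Set.Ioi (0 : ℝ), f x := by
    have := setLIntegral_Iic_neg_comp_abs f hf 0
    rw [neg_zero] at this
    rw [this, ← setLIntegral_congr (Ioi_ae_eq_Ici (a := (0 : ℝ)) (μ := volume)), h1]
  rw [← lintegral_add_compl _ (measurableSet_Iic (a := (0 : ℝ))), Set.compl_Iic, h1, h2, two_mul]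

lemma gaussianPDFReal_sq_scale (x : ℝ) {l : ℝ} (hl : 0 < l) :
    gaussianPDFReal 0 (l ^ 2).toNNReal x =
      (Real.sqrt (2 * Real.pi) * l)⁻¹ * Real.exp (-(x ^ 2 / (2 * l ^ 2))) := by
  rw [gaussianPDFReal, Real.coe_toNNReal _ (sq_nonneg l), Real.sqrt_mul' _ (sq_nonneg l),
    Real.sqrt_sq hl.le, sub_zero, neg_div]

lemma measurable_horseshoe_integrand : Measurable fun q : ℝ × ℝ =>
    gaussianPDF 0 (q.2 ^ 2).toNNReal q.1 * ENNReal.ofReal (2 / (Real.pi * (1 + q.2 ^ 2))) := by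
  have h' : Measurable fun q : ℝ × ℝ => ENNReal.ofReal (2 / (Real.pi * (1 + q.2 ^ 2))) := by
    fun_prop
  have h : Measurable fun q : ℝ × ℝ => ((0 : ℝ), (q.2 ^ 2).toNNReal, q.1) := by fun_prop
  exact (measurable_uncurry_gaussianPDF.comp h).mul h'

lemma lintegral_horseshoeDensity : ∫⁻ x, horseshoeDensity x = 1 := by
  unfold horseshoeDensity
  rw [lintegral_lintegral_swap measurable_horseshoe_integrand.aemeasurable]
  have h1 : ∀ l ∈ Set.Ioi (0 : ℝ), ∫⁻ x, gaussianPDF 0 (l ^ 2).toNNReal x *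
      ENNReal.ofReal (2 / (Real.pi * (1 + l ^ 2))) =
      ENNReal.ofReal (2 / Real.pi * (1 + l ^ 2)⁻¹) := by
    intro l hl
    have hl0 : (0 : ℝ) < l := hl
    rw [lintegral_mul_const' _ _ ENNReal.ofReal_ne_top, lintegral_gaussianPDF_eq_one, one_mul]
    · congr 1; field_simp
    · have : (0 : ℝ) < l ^ 2 := by positivity
      simpa using hl0.ne'
  rw [setLIntegral_congr_fun measurableSet_Ioi h1, ← ofReal_integral_eq_lintegral_ofReal
    (integrable_inv_one_add_sq.integrableOn.const_mul _) (ae_of_all _ fun l => by positivity),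
    integral_const_mul, integral_Ioi_inv_one_add_sq]
  rw [Real.arctan_zero, sub_zero, div_mul_div_comm, mul_comm, div_self (by positivity),
    ENNReal.ofReal_one]

lemma abs_rpow_neg_two (x : ℝ) : |x| ^ (-2 : ℝ) = (|x| ^ 2)⁻¹ := by
  rw [Real.rpow_neg (abs_nonneg x)]
  congr 1
  exact Real.rpow_natCast |x| 2

/-- Scales `l` between `|x|` and `2 |x|` suffice: there the Gaussian exponent is at least `-1/2`,
and the integrand has order `|x|⁻³` on an interval of length `|x|`. -/
lemma le_horseshoeDensity {x : ℝ} (hx : 1 ≤ |x|) :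
    ENNReal.ofReal (Real.exp (-1 / 2) / (5 * Real.pi * Real.sqrt (2 * Real.pi)) *
      |x| ^ (-2 : ℝ)) ≤ horseshoeDensity x := by
  have hx0 : 0 < |x| := by linarith
  set t := |x| with ht
  set q := Real.sqrt (2 * Real.pi) with hq
  have hq0 : 0 < q := Real.sqrt_pos.2 (by positivity)
  have hpi := Real.pi_pos
  rw [horseshoeDensity, abs_rpow_neg_two]
  calc ENNReal.ofReal (Real.exp (-1 / 2) / (5 * Real.pi * q) * (t ^ 2)⁻¹)
      = ENNReal.ofReal ((q * (2 * t))⁻¹ * Real.exp (-1 / 2) * (2 / (Real.pi * (5 * t ^ 2)))) *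
          volume (Set.Icc t (2 * t)) := by
        rw [Real.volume_Icc, ← ENNReal.ofReal_mul (by positivity)]
        congr 1
        field_simp
        ring
    _ = ∫⁻ _ in Set.Icc t (2 * t),
          ENNReal.ofReal ((q * (2 * t))⁻¹ * Real.exp (-1 / 2) * (2 / (Real.pi * (5 * t ^ 2)))) := by
        rw [setLIntegral_const]
    _ ≤ ∫⁻ l in Set.Icc t (2 * t), gaussianPDF 0 (l ^ 2).toNNReal x *
          ENNReal.ofReal (2 / (Real.pi * (1 + l ^ 2))) := by
        refine setLIntegral_mono' measurableSet_Icc fun l hl => ?_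
        have hl0 : 0 < l := hx0.trans_le hl.1
        have hl2 : t ^ 2 ≤ l ^ 2 := pow_le_pow_left₀ hx0.le hl.1 2
        have hl3 : l ^ 2 ≤ (2 * t) ^ 2 := pow_le_pow_left₀ hl0.le hl.2 2
        rw [gaussianPDF, gaussianPDFReal_sq_scale x hl0, ← hq, ← ENNReal.ofReal_mul (by positivity)]
        refine ENNReal.ofReal_le_ofReal ?_
        have h1 : Real.exp (-1 / 2) ≤ Real.exp (-(x ^ 2 / (2 * l ^ 2))) := by
          refine Real.exp_le_exp.2 ?_
          have : x ^ 2 / (2 * l ^ 2) ≤ 1 / 2 := by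
            rw [← sq_abs, ← ht, div_le_div_iff₀ (by positivity) (by norm_num)]
            linarith
          linarith
        have h2 : (q * (2 * t))⁻¹ ≤ (q * l)⁻¹ :=
          inv_anti₀ (by positivity) (mul_le_mul_of_nonneg_left hl.2 hq0.le)
        have h3 : 2 / (Real.pi * (5 * t ^ 2)) ≤ 2 / (Real.pi * (1 + l ^ 2)) := by
          refine div_le_div_of_nonneg_left (by norm_num) (by positivity)
            (mul_le_mul_of_nonneg_left ?_ hpi.le)
          nlinarith
        gcongr
    _ ≤ _ := lintegral_mono_set fun l hl => hx0.trans_le hl.1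

/-- Split at `l = |x|`. Below, `exp (-y) ≤ 2 / y²` cancels the singularity in `l` and gives the
constant 16; above, the exponential is dropped and the tail of `l⁻³` gives 2. -/
lemma horseshoeDensity_le {x : ℝ} (hx : 1 ≤ |x|) : horseshoeDensity x ≤
    ENNReal.ofReal (18 / (Real.pi * Real.sqrt (2 * Real.pi)) * |x| ^ (-2 : ℝ)) := by
  have hx0 : 0 < |x| := by linarith
  set t := |x| with ht
  set q := Real.sqrt (2 * Real.pi) with hq
  have hq0 : 0 < q := Real.sqrt_pos.2 (by positivity)
  have hpi := Real.pi_pos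
  have hsub : Set.Ioi (0 : ℝ) ⊆ Set.Ioc 0 t ∪ {l | t ≤ |l|} := by
    intro l hl
    have hl' : (0 : ℝ) < l := hl
    rcases le_total l t with h | h
    · exact Or.inl ⟨hl', h⟩
    · exact Or.inr (h.trans (le_abs_self l))
  have hnear : ∫⁻ l in Set.Ioc 0 t, gaussianPDF 0 (l ^ 2).toNNReal x *
      ENNReal.ofReal (2 / (Real.pi * (1 + l ^ 2))) ≤
      ENNReal.ofReal (16 / (Real.pi * q) * (t ^ 2)⁻¹) := by
    calc _ ≤ ∫⁻ _ in Set.Ioc 0 t, ENNReal.ofReal (16 / (Real.pi * q) * (t ^ 3)⁻¹) := by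
          refine setLIntegral_mono' measurableSet_Ioc fun l hl => ?_
          have hl0 : 0 < l := hl.1
          rw [gaussianPDF, gaussianPDFReal_sq_scale x hl0, ← hq,
            ← ENNReal.ofReal_mul (by positivity)]
          refine ENNReal.ofReal_le_ofReal ?_
          rw [← sq_abs, ← ht]
          set y := t ^ 2 / (2 * l ^ 2) with hy
          have hy0 : 0 < y := by positivity
          have h1 : Real.exp (-y) ≤ 2 / y ^ 2 := by
            rw [Real.exp_neg, inv_le_comm₀ (Real.exp_pos _) (by positivity), inv_div]
            have := Real.quadratic_le_exp_of_nonneg hy0.le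
            linarith
          have h2 : 2 / y ^ 2 = 8 * l ^ 4 / t ^ 4 := by
            rw [hy]; field_simp; norm_num
          have h3 : 2 / (Real.pi * (1 + l ^ 2)) ≤ 2 / (Real.pi * l ^ 2) := by
            refine div_le_div_of_nonneg_left (by norm_num) (by positivity)
              (mul_le_mul_of_nonneg_left (by linarith) hpi.le)
          calc (q * l)⁻¹ * Real.exp (-y) * (2 / (Real.pi * (1 + l ^ 2)))
              ≤ (q * l)⁻¹ * (8 * l ^ 4 / t ^ 4) * (2 / (Real.pi * l ^ 2)) := by
                rw [← h2]; gcongr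
            _ = 16 / (Real.pi * q) * (t ^ 4)⁻¹ * l := by field_simp; ring
            _ ≤ 16 / (Real.pi * q) * (t ^ 4)⁻¹ * t :=
                mul_le_mul_of_nonneg_left hl.2 (by positivity)
            _ = 16 / (Real.pi * q) * (t ^ 3)⁻¹ := by field_simp
      _ = _ := by
          rw [setLIntegral_const, Real.volume_Ioc, ← ENNReal.ofReal_mul (by positivity)]
          congr 1
          field_simp
          ring
  have hfar : ∫⁻ l in {l | t ≤ |l|}, gaussianPDF 0 (l ^ 2).toNNReal x *
      ENNReal.ofReal (2 / (Real.pi * (1 + l ^ 2))) ≤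
      ENNReal.ofReal (2 / (Real.pi * q) * (t ^ 2)⁻¹) := by
    calc _ ≤ ∫⁻ l in {l | t ≤ |l|}, ENNReal.ofReal (2 / (Real.pi * q) * |l| ^ (-3 : ℝ)) := by
          refine setLIntegral_mono' (measurableSet_le measurable_const measurable_norm)
            fun l hl => ?_
          have hl0 : 0 < |l| := hx0.trans_le hl
          rw [← sq_abs l, gaussianPDF, gaussianPDFReal_sq_scale x hl0, ← hq,
            ← ENNReal.ofReal_mul (by positivity)]
          refine ENNReal.ofReal_le_ofReal ?_
          have h3 : 2 / (Real.pi * (1 + |l| ^ 2)) ≤ 2 / (Real.pi * |l| ^ 2) := by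
            refine div_le_div_of_nonneg_left (by norm_num) (by positivity)
              (mul_le_mul_of_nonneg_left (by linarith) hpi.le)
          have h4 : |l| ^ (-3 : ℝ) = (|l| ^ 3)⁻¹ := by
            rw [Real.rpow_neg (abs_nonneg l)]
            congr 1
            exact Real.rpow_natCast |l| 3
          have h5 : Real.exp (-(x ^ 2 / (2 * |l| ^ 2))) ≤ 1 :=
            Real.exp_le_one_iff.2 (neg_nonpos.2 (by positivity))
          calc (q * |l|)⁻¹ * Real.exp (-(x ^ 2 / (2 * |l| ^ 2))) * (2 / (Real.pi * (1 + |l| ^ 2)))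
              ≤ (q * |l|)⁻¹ * 1 * (2 / (Real.pi * |l| ^ 2)) := by gcongr
            _ = 2 / (Real.pi * q) * |l| ^ (-3 : ℝ) := by rw [h4]; field_simp
      _ ≤ _ := by
          refine (lintegral_rpow_tail_le (r := 3) (by positivity) (by norm_num) hx0).trans
            (ENNReal.ofReal_le_ofReal (le_of_eq ?_))
          have : t ^ (1 - 3 : ℝ) = (t ^ 2)⁻¹ := by
            rw [show (1 - 3 : ℝ) = -2 by norm_num, Real.rpow_neg hx0.le]
            congr 1
            exact Real.rpow_natCast t 2
          rw [this]; field_simp; norm_num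
  rw [horseshoeDensity, abs_rpow_neg_two, ← ht]
  refine (lintegral_mono_set hsub).trans ((lintegral_union_le _ _ _).trans
    ((add_le_add hnear hfar).trans (le_of_eq ?_)))
  rw [← ENNReal.ofReal_add (by positivity) (by positivity)]
  congr 1
  ring

theorem isPolyTailDensity_horseshoe : IsPolyTailDensity horseshoeDensity 2 where
  measurable := measurable_horseshoe_integrand.lintegral_prod_right'
  lintegral_eq_one := lintegral_horseshoeDensity
  tail := by
    have := Real.pi_pos
    exact ⟨_, _, 1, by positivity, by positivity, fun x hx =>
      ⟨le_horseshoeDensity hx, horseshoeDensity_le hx⟩⟩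

theorem isPolyTailDensity_gdp {ξ α : ℝ} (hξ : 0 < ξ) (hα : 0 < α) :
    IsPolyTailDensity (gdpDensity ξ α) (1 + α) where
  measurable := by unfold gdpDensity; fun_prop
  lintegral_eq_one := by
    set b := α * ξ with hb
    have hb0 : 0 < b := by positivity
    let f : ℝ → ℝ≥0∞ := fun x => ENNReal.ofReal (1 / (2 * ξ) * (1 + x / b) ^ (-(1 + α)))
    have hf : Measurable f := by fun_prop
    let g : ℝ → ℝ≥0∞ := fun y => ENNReal.ofReal (1 / (2 * ξ) * b ^ (1 + α) * y ^ (-(1 + α)))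
    have hg : Measurable g := by fun_prop
    have h1 : ∫⁻ x in Set.Ioi (0 : ℝ), f x = ∫⁻ x in Set.Ioi (0 : ℝ), g (x + b) := by
      refine setLIntegral_congr_fun measurableSet_Ioi fun x hx => ?_
      have hx0 : (0 : ℝ) < x := hx
      simp only [f, g]
      congr 1
      have : 1 + x / b = (x + b) / b := by field_simp; ring
      rw [this, Real.div_rpow (by positivity) hb0.le, Real.rpow_neg hb0.le, div_inv_eq_mul]
      ring
    have h2 : ∫⁻ x in Set.Ioi (0 : ℝ), g (x + b) = ∫⁻ y in Set.Ioi b, g y := by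
      have := (measurePreserving_add_right (volume : Measure ℝ) b).setLIntegral_comp_preimage
        (s := Set.Ioi b) measurableSet_Ioi hg
      rw [← this]
      congr 2
      ext x; simp
    have h3 : ∫⁻ y in Set.Ioi b, g y = ENNReal.ofReal (1 / 2) := by
      rw [← ofReal_integral_eq_lintegral_ofReal
        ((integrableOn_Ioi_rpow_of_lt (by linarith) hb0).const_mul _)
        ((ae_restrict_iff' measurableSet_Ioi).2 (ae_of_all _ fun y hy => ?_)),
        integral_const_mul, integral_Ioi_rpow_of_lt (by linarith) hb0]
      · congr 1
        rw [show -(1 + α) + 1 = -α by ring, Real.rpow_add hb0, Real.rpow_one, Real.rpow_neg hb0.le,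
          hb]
        have : (α * ξ) ^ α ≠ 0 := (Real.rpow_pos_of_pos hb0 _).ne'
        field_simp
      · have : 0 < y := hb0.trans hy
        positivity
    calc ∫⁻ x, gdpDensity ξ α x = ∫⁻ x, f |x| := rfl
      _ = 1 := by
        rw [lintegral_comp_abs_eq f hf, h1, h2, h3]
        have : (2 : ℝ≥0∞) = ENNReal.ofReal 2 := by simp
        rw [this, ← ENNReal.ofReal_mul (by norm_num)]
        norm_num
  tail := by
    set b := α * ξ with hb
    have hb0 : 0 < b := by positivity
    refine ⟨1 / (2 * ξ) * (2 / b) ^ (-(1 + α)), 1 / (2 * ξ) * (1 / b) ^ (-(1 + α)), b,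
      by positivity, by positivity, fun x hx => ?_⟩
    have hx0 : 0 < |x| := hb0.trans_le hx
    have h1 : 1 ≤ |x| / b := by rw [one_le_div hb0]; exact hx
    have hlow : (2 / b * |x|) ^ (-(1 + α)) ≤ (1 + |x| / b) ^ (-(1 + α)) := by
      refine Real.rpow_le_rpow_of_nonpos (by positivity) ?_ (by linarith)
      have : 2 / b * |x| = 2 * (|x| / b) := by ring
      linarith
    have hup : (1 + |x| / b) ^ (-(1 + α)) ≤ (1 / b * |x|) ^ (-(1 + α)) := by
      refine Real.rpow_le_rpow_of_nonpos (by positivity) ?_ (by linarith)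
      have : 1 / b * |x| = |x| / b := by ring
      linarith
    rw [Real.mul_rpow (by positivity) hx0.le] at hlow hup
    have hc : 0 ≤ 1 / (2 * ξ) := by positivity
    constructor
    · refine ENNReal.ofReal_le_ofReal ?_
      rw [mul_assoc]; exact mul_le_mul_of_nonneg_left hlow hc
    · refine ENNReal.ofReal_le_ofReal ?_
      rw [mul_assoc]; exact mul_le_mul_of_nonneg_left hup hc

/-! ### Posterior contraction -/

/-- The posterior probability of the exceptional set, averaged over the sketching matrix. -/
theorem lintegral_expectedPosterior_le {m n p : ℕ} (π : Measure (Fin p → ℝ))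
    [IsProbabilityMeasure π] (X : Matrix (Fin n) (Fin p) ℝ) (hX : ∀ i j, |X i j| ≤ 1)
    (βs : Fin p → ℝ) {A : ℕ} {L R a d u η B Q E : ℝ} (hA : 1 ≤ A) (hs : 1 ≤ sparsity βs)
    (hL : 0 ≤ L) (hR0 : 0 ≤ R) (ha : 0 ≤ a) (hpa : p * a ≤ R) (hR : m * R ^ 2 = sparsity βs * L)
    (hd0 : 0 ≤ d) (hd1 : d ≤ 1) (hdu : 74 * d ≤ u / 2) (hη : 0 < η) (hη1 : η ≤ 1)
    (hgram : ∀ ξ : Finset (Fin p), activeSet βs ⊆ ξ → ξ.card ≤ (A + 1) * sparsity βs →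
      ∀ e ∈ spectrum ℝ (gram X ξ), η ≤ e)
    (hbox : ENNReal.ofReal (Real.exp (-(B * (sparsity βs * L)))) ≤
      π {β | ∀ j, |β j - βs j| ≤ a}) (hQ0 : 0 ≤ Q)
    (hQ : ∫⁻ β, ENNReal.ofReal (Real.exp (u * L * numLarge a β)) ∂π ≤ ENNReal.ofReal Q)
    (hE : 1 ≤ E) :
    ∫⁻ Φ, expectedPosterior π X βs (exceptionalSet βs (E * R) a (A * sparsity βs))
        (Matrix.of Φ) ∂(sketchLaw m n) ≤
      (1 - sketchLaw m n {Φ | spectralNorm (Matrix.of Φ * (Matrix.of Φ)ᵀ - 1) ≤ d}) +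
      ENNReal.ofReal (p * Real.exp (-(m / 2))) +
      ENNReal.ofReal ((48 * p ^ 2 / Real.sqrt η) ^ ((A + 1) * sparsity βs) * Real.exp 1 *
        Real.exp (-(m / 2))) +
      (ENNReal.ofReal ((1 + Real.sqrt 2 * Real.exp (-(2 * L))) ^ p - 1) +
      ENNReal.ofReal (Real.exp ((B + 10) * (sparsity βs * L)) *
        (Q * Real.exp (-(u / 2 * A * (sparsity βs * L))) +
          Real.exp ((42 + 32 * A - η / 256 * E ^ 2 / 2) * (sparsity βs * L))))) := by
  set F₁ : Set (Fin m → Fin n → ℝ) :=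
    {Φ | spectralNorm (Matrix.of Φ * (Matrix.of Φ)ᵀ - 1) ≤ d} with hF₁
  let F₂ : Set (Fin m → Fin n → ℝ) :=
    {Φ | ¬ ∀ j, l2norm (fun i => (Matrix.of Φ * X) i j) ≤ 2 * Real.sqrt m}
  -- The column bound is built in because the volume argument needs it; its failure is charged to
  -- `F₂`.
  let F₃ : Set (Fin m → Fin n → ℝ) :=
    {Φ | (∀ j, l2norm (fun i => (Matrix.of Φ * X) i j) ≤ 2 * Real.sqrt m) ∧
        ¬ ∀ S : Finset (Fin p), activeSet βs ⊆ S → S.card ≤ (A + 1) * sparsity βs →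
          ∀ v : Fin p → ℝ, (∀ j ∉ S, v j = 0) → η / 256 * m * (v ⬝ᵥ v) ≤
            ((Matrix.of Φ * X) *ᵥ v) ⬝ᵥ ((Matrix.of Φ * X) *ᵥ v)}
  refine (lintegral_le_measure_add (sketchLaw m n) (B := F₁ᶜ ∪ F₂ ∪ F₃)
    (fun Φ => expectedPosterior_le_one _ _ _ _ _) (g := fun _ => _) (fun Φ hΦ => ?_)).trans
    (add_le_add ?_ (le_of_eq (by rw [lintegral_const, measure_univ, mul_one])))
  · simp only [Set.mem_union, not_or, Set.mem_compl_iff, not_not] at hΦ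
    obtain ⟨⟨h1, h2⟩, h3⟩ := hΦ
    have hcol := not_not.1 h2
    have hRE : ∀ S : Finset (Fin p), activeSet βs ⊆ S → S.card ≤ (A + 1) * sparsity βs →
          ∀ v : Fin p → ℝ, (∀ j ∉ S, v j = 0) → η / 256 * m * (v ⬝ᵥ v) ≤
            ((Matrix.of Φ * X) *ᵥ v) ⬝ᵥ ((Matrix.of Φ * X) *ᵥ v) := by
      by_contra hne
      exact h3 ⟨hcol, hne⟩
    exact expectedPosterior_le π X βs (Matrix.of Φ) hA hs hL hR0 ha hpa hR hcol hd0 hd1 hdu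
      (dotProduct_mulVec_transpose_self _ h1) (by positivity) hRE hbox hQ0 hQ hE
  · refine (measure_union_le _ _).trans (add_le_add ((measure_union_le _ _).trans
      (add_le_add (le_of_eq ?_) (sketchLaw_col_le X hX)))
      (sketchLaw_restrictedEigenvalue_le X (Finset.card_pos.1 hs) hη hη1 hgram))
    rw [prob_compl_eq_one_sub (measurableSet_spectralNorm_le m n d)]

lemma natCast_mul_rate_sq {s p m : ℕ} (hm : 0 < m) : (m : ℝ) * rate s p m ^ 2 = s * Real.log p := by
  have hm' : (0 : ℝ) < m := by exact_mod_cast hm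
  have := Real.log_natCast_nonneg p
  rw [rate, Real.sq_sqrt (by positivity)]
  field_simp

/-- At `L = log p` the union bound over supports vanishes: `p exp (-2 L) = exp (-L)`. -/
lemma one_add_pow_sub_one_le {p : ℕ} (hp : 0 < p) :
    (1 + Real.sqrt 2 * Real.exp (-(2 * Real.log p))) ^ p - 1 ≤
      Real.exp (Real.sqrt 2 * Real.exp (-Real.log p)) - 1 := by
  have hp' : (0 : ℝ) < p := by exact_mod_cast hp
  have h1 : (p : ℝ) * (Real.sqrt 2 * Real.exp (-(2 * Real.log p))) =
      Real.sqrt 2 * Real.exp (-Real.log p) := by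
    nth_rewrite 1 [← Real.exp_log hp']
    rw [mul_left_comm, ← Real.exp_add]
    congr 2; ring
  rw [← h1, Real.exp_nat_mul]
  gcongr
  rw [add_comm]; exact Real.add_one_le_exp _

/-- The prior mass of a box around the truth and the exponential moments of the number of large
coordinates, for `p` coordinates and a sufficiently small scale `μ`. -/
lemma exists_prior_bounds {h : ℝ → ℝ≥0∞} {r u cM cμ : ℝ} (hh : IsPolyTailDensity h r) (hr : 1 < r)
    (hu : 0 < u) :
    ∃ B Q : ℝ, 0 ≤ B ∧ 0 ≤ Q ∧ ∀ᶠ p : ℕ in atTop, ∀ (βs : Fin p → ℝ) (a μ : ℝ),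
      1 ≤ sparsity βs → 0 < μ → 0 < a → a ≤ 1 → μ ≤ a * (p : ℝ) ^ (-(u + 1) / (r - 1)) →
      Real.exp (-(cμ * Real.log p)) ≤ μ →
      (∀ j ∈ activeSet βs, |βs j| ≤ Real.exp (|cM| * Real.log p)) →
      ENNReal.ofReal (Real.exp (-(B * (sparsity βs * Real.log p)))) ≤
        prior p h μ {β | ∀ j, |β j - βs j| ≤ a} ∧
      ∫⁻ β, ENNReal.ofReal (Real.exp (u * Real.log p * numLarge a β)) ∂(prior p h μ) ≤
        ENNReal.ofReal Q := by
  obtain ⟨C, R₁, hC, htail⟩ := hh.exists_coordLaw_tail_le hr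
  obtain ⟨c, R₂, hc, hbox⟩ := hh.exists_le_coordLaw hr
  -- `p ^ D` bounds `(|βs j| + a) / μ`: the three terms account for the coefficient, the added `a ≤
  -- 1` and the division by `μ`.
  set D : ℝ := |cM| + 1 + |cμ| with hD
  have hD0 : 0 ≤ D := by positivity
  have hr1 : 0 < r - 1 := by linarith
  -- `r D` comes from the tail `(p ^ D) ^ (-r)`; the extra `2` absorbs the constant `c` per active
  -- coordinate and the factor `1/2` from the inactive ones.
  refine ⟨r * D + 2, Real.exp C, by positivity, (Real.exp_pos _).le, ?_⟩
  have hcast : Tendsto (fun p : ℕ => (p : ℝ)) atTop atTop := tendsto_natCast_atTop_atTop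
  have hlog : Tendsto (fun p : ℕ => Real.log p) atTop atTop := Real.tendsto_log_atTop.comp hcast
  have hpow : Tendsto (fun p : ℕ => (p : ℝ) ^ ((u + 1) / (r - 1))) atTop atTop :=
    (tendsto_rpow_atTop (by positivity)).comp hcast
  have hsmall : Tendsto (fun p : ℕ => C * Real.exp (-(u * Real.log p))) atTop (𝓝 0) := by
    have : Tendsto (fun p : ℕ => Real.exp (-(u * Real.log p))) atTop (𝓝 0) :=
      Real.tendsto_exp_neg_atTop_nhds_zero.comp (hlog.const_mul_atTop hu)
    simpa using this.const_mul C
  filter_upwards [eventually_ge_atTop 1, hlog.eventually_ge_atTop 1,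
    hpow.eventually_ge_atTop (max R₁ R₂), hsmall.eventually_le_const (by norm_num : (0 : ℝ) < 1 / 2),
    hlog.eventually_ge_atTop (-Real.log c)] with p hp1 hL1 hpR hpC hpc βs a μ hs hμ ha ha1 hμa hμL hβ
  set L := Real.log p with hL
  have hp0 : (0 : ℝ) < p := by exact_mod_cast hp1
  have hP := isProbabilityMeasure_coordLaw hh hμ
  have hratio : (p : ℝ) ^ ((u + 1) / (r - 1)) ≤ a / μ := by
    rw [le_div_iff₀ hμ]
    calc (p : ℝ) ^ ((u + 1) / (r - 1)) * μ ≤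
          (p : ℝ) ^ ((u + 1) / (r - 1)) * (a * (p : ℝ) ^ (-(u + 1) / (r - 1))) :=
          mul_le_mul_of_nonneg_left hμa (Real.rpow_nonneg hp0.le _)
      _ = a * ((p : ℝ) ^ ((u + 1) / (r - 1)) * (p : ℝ) ^ (-(u + 1) / (r - 1))) := by ring
      _ = a := by
          rw [← Real.rpow_add hp0, neg_div, add_neg_cancel, Real.rpow_zero, mul_one]
  have htail' : coordLaw h μ {x | a ≤ |x|} ≤
      ENNReal.ofReal (C / p * Real.exp (-(u * L))) := by
    refine (htail μ a hμ ha (((le_max_left _ _).trans hpR).trans hratio)).trans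
      (ENNReal.ofReal_le_ofReal ?_)
    have h1 : (a / μ) ^ (1 - r) ≤ ((p : ℝ) ^ ((u + 1) / (r - 1))) ^ (1 - r) :=
      Real.rpow_le_rpow_of_nonpos (Real.rpow_pos_of_pos hp0 _) hratio (by linarith)
    -- The exponent in the scale condition is designed for this: the tail is `p ^ (-(u + 1))`, one
    -- power for the number of coordinates and `u` powers for the exponential weight.
    have h2 : ((p : ℝ) ^ ((u + 1) / (r - 1))) ^ (1 - r) = 1 / p * Real.exp (-(u * L)) := by
      rw [← Real.rpow_mul hp0.le, Real.rpow_def_of_pos hp0]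
      have h3 : (1 : ℝ) / p = Real.exp (-L) := by
        rw [Real.exp_neg, hL, Real.exp_log hp0, one_div]
      rw [h3, ← Real.exp_add]
      congr 1
      rw [← hL]
      field_simp
      ring
    rw [h2] at h1
    calc C * (a / μ) ^ (1 - r) ≤ C * (1 / p * Real.exp (-(u * L))) :=
          mul_le_mul_of_nonneg_left h1 hC.le
      _ = C / p * Real.exp (-(u * L)) := by ring
  refine ⟨?_, lintegral_exp_numLarge_prior_le hC.le hp1 htail'⟩
  set N : ℝ := Real.exp (D * L) with hN
  have hactive : ∀ j ∈ activeSet βs,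
      ENNReal.ofReal (c * N ^ (-r)) ≤ coordLaw h μ {x | |x - βs j| ≤ a} := by
    intro j hj
    refine hbox μ a (βs j) N hμ ha (((le_max_right _ _).trans hpR).trans hratio) ?_
    rw [div_le_iff₀ hμ]
    have h1 : |βs j| + a ≤ Real.exp ((|cM| + 1) * L) := by
      have h2 : 1 ≤ Real.exp (|cM| * L) := Real.one_le_exp (by positivity)
      have h3 : 2 ≤ Real.exp L := by
        have := Real.add_one_le_exp L
        linarith
      rw [add_mul, one_mul, Real.exp_add]
      nlinarith [hβ j hj]
    refine h1.trans ?_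
    calc Real.exp ((|cM| + 1) * L) ≤ N * Real.exp (-(cμ * L)) := by
          rw [hN, ← Real.exp_add, hD]
          refine Real.exp_le_exp.2 ?_
          nlinarith [le_abs_self cμ]
      _ ≤ N * μ := mul_le_mul_of_nonneg_left hμL (Real.exp_pos _).le
  have hg : Real.exp (-((r * D + 1) * L)) ≤ c * N ^ (-r) := by
    have h1 : Real.exp (-L) ≤ c := by
      rw [← Real.exp_log hc]
      exact Real.exp_le_exp.2 (by linarith)
    have h2 : N ^ (-r) = Real.exp (-(r * D * L)) := by
      rw [hN, ← Real.exp_mul]; congr 1; ring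
    rw [h2]
    calc Real.exp (-((r * D + 1) * L)) = Real.exp (-L) * Real.exp (-(r * D * L)) := by
          rw [← Real.exp_add]; congr 1; ring
      _ ≤ _ := mul_le_mul_of_nonneg_right h1 (Real.exp_pos _).le
  have hs1 : (1 : ℝ) ≤ sparsity βs := by exact_mod_cast hs
  refine le_trans (ENNReal.ofReal_le_ofReal ?_) (le_prior_box (by positivity) hp1
    (htail'.trans (ENNReal.ofReal_le_ofReal ?_)) hactive)
  · have h1 : Real.exp (-(sparsity βs * L)) ≤ 1 / 2 := by
      have h2 : 2 ≤ Real.exp (sparsity βs * L) := by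
        have := Real.add_one_le_exp (sparsity βs * L)
        nlinarith
      rw [Real.exp_neg, ← one_div]
      exact one_div_le_one_div_of_le (by norm_num) h2
    calc Real.exp (-((r * D + 2) * (sparsity βs * L)))
        = Real.exp (-((r * D + 1) * L)) ^ sparsity βs * Real.exp (-(sparsity βs * L)) := by
          rw [← Real.exp_nat_mul, ← Real.exp_add]; congr 1; ring
      _ ≤ (c * N ^ (-r)) ^ sparsity βs * (1 / 2) :=
          mul_le_mul (pow_le_pow_left₀ (Real.exp_pos _).le hg _) h1 (Real.exp_pos _).le
            (by positivity)
      _ = _ := by ring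
  · calc C / p * Real.exp (-(u * L)) = (C * Real.exp (-(u * L))) / p := by ring
      _ ≤ 1 / 2 / p := div_le_div_of_nonneg_right hpC hp0.le
      _ = 1 / (2 * p) := by ring

/-- Exponents beyond `B + 11` outweigh the reciprocal `exp ((B + 10) l)` of the denominator bound
and still leave `exp (-l)`. -/
lemma exp_mul_add_le {B Q l x y : ℝ} (hl : 0 ≤ l) (hQ : 0 ≤ Q) (hx : B + 11 ≤ x)
    (hy : y ≤ -(B + 11)) :
    Real.exp ((B + 10) * l) * (Q * Real.exp (-(x * l)) + Real.exp (y * l)) ≤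
      (Q + 1) * Real.exp (-l) := by
  have h1 : Real.exp ((B + 10) * l) * Real.exp (-(x * l)) ≤ Real.exp (-l) := by
    rw [← Real.exp_add]; exact Real.exp_le_exp.2 (by nlinarith)
  have h2 : Real.exp ((B + 10) * l) * Real.exp (y * l) ≤ Real.exp (-l) := by
    rw [← Real.exp_add]; exact Real.exp_le_exp.2 (by nlinarith)
  nlinarith [mul_le_mul_of_nonneg_left h1 hQ]

/-- Once `p ≥ 48 / q` the base is at most `p ^ 3`, so the union over supports costs `exp (3 k log
p)`, half of the available exponent `M / 2` at most. -/
lemma pow_mul_exp_le {p k : ℕ} {q M : ℝ} (hq : 0 < q) (hp : 0 < p) (hqL : Real.log (48 / q) ≤ Real.log p)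
    (hk : 3 * (k * Real.log p) ≤ M / 4) :
    (48 * (p : ℝ) ^ 2 / q) ^ k * Real.exp 1 * Real.exp (-(M / 2)) ≤
      Real.exp 1 * Real.exp (-(M / 4)) := by
  have hp' : (0 : ℝ) < p := by exact_mod_cast hp
  have h1 : 48 * (p : ℝ) ^ 2 / q ≤ Real.exp (3 * Real.log p) := by
    rw [← Real.exp_log (show 0 < 48 * (p : ℝ) ^ 2 / q by positivity)]
    refine Real.exp_le_exp.2 ?_
    rw [mul_div_right_comm, Real.log_mul (by positivity) (by positivity), Real.log_pow]
    push_cast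
    linarith
  have h2 : (48 * (p : ℝ) ^ 2 / q) ^ k ≤ Real.exp (M / 4) := by
    refine (pow_le_pow_left₀ (by positivity) h1 k).trans ?_
    rw [← Real.exp_nat_mul]
    exact Real.exp_le_exp.2 (by linarith)
  calc (48 * (p : ℝ) ^ 2 / q) ^ k * Real.exp 1 * Real.exp (-(M / 2))
      ≤ Real.exp (M / 4) * Real.exp 1 * Real.exp (-(M / 2)) := by gcongr
    _ = Real.exp 1 * Real.exp (-(M / 4)) := by
        rw [mul_comm (Real.exp (M / 4)), mul_assoc, ← Real.exp_add]; congr 2; ring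

end Sketch

end

/-! ### Choice of the constants and passage to the limit -/

theorem theorem2 :
    (∀ (p m : ℕ → ℕ) (X : (n : ℕ) → Matrix (Fin n) (Fin (p n)) ℝ)
      (βs : (n : ℕ) → Fin (p n) → ℝ) (s : ℕ → ℕ) (a : ℕ → ℝ) (M μ : ℕ → ℝ)
      (h : ℝ → ℝ≥0∞) (r u' η C' : ℝ) (sbar : ℕ → ℕ),
      -- notation: sparsity of the truth and threshold
      (∀ n, s n = Sketch.sparsity (βs n)) →
      (∀ n, a n = Sketch.threshold (s n) (p n) (m n)) →
      -- the dimensions grow with the sample size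
      Tendsto p atTop atTop →
      Tendsto m atTop atTop →
      -- bounded covariates
      (∀ᶠ n in atTop, ∀ i j, |X n i j| ≤ 1) →
      -- the Gaussian sketch is nearly orthonormal, with probability tending to one
      0 < C' →
      Tendsto (fun n => Sketch.sketchLaw (m n) n
        {Φ | Sketch.spectralNorm (Matrix.of Φ * (Matrix.of Φ)ᵀ - 1) ≤
          C' * Real.sqrt ((m n : ℝ) / n)}) atTop (𝓝 1) →
      -- growth of the sparsity and of the sketch
      ((fun n => (s n : ℝ) * Real.log (p n)) =o[atTop] fun n => (m n : ℝ)) →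
      ((fun n => (m n : ℝ)) =o[atTop] fun n => (n : ℝ)) →
      -- sparse eigenvalues are bounded below
      0 < η →
      ((fun n => (s n : ℝ)) =o[atTop] fun n => (sbar n : ℝ)) →
      (∀ᶠ n in atTop, ∀ ξ : Finset (Fin (p n)), Sketch.activeSet (βs n) ⊆ ξ → ξ.card ≤ sbar n →
        ∀ e ∈ spectrum ℝ (Sketch.gram (X n) ξ), η ≤ e) →
      -- size of the true coefficients
      Monotone M →
      (∀ᶠ n in atTop, ∀ j ∈ Sketch.activeSet (βs n), |βs n j| < M n / 2) →
      ((fun n => Real.log (M n)) =O[atTop] fun n => Real.log (p n)) →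
      -- the prior
      1 < r →
      Sketch.IsPolyTailDensity h r →
      0 < u' →
      (∀ᶠ n in atTop, 0 < μ n) →
      (∀ᶠ n in atTop, μ n ≤ a n * (p n : ℝ) ^ (-(u' + 1) / (r - 1))) →
      ((fun n => Real.log (μ n)) =O[atTop] fun n => Real.log (p n)) →
      ∃ E : ℝ, 0 < E ∧ ∃ stilde : ℕ → ℕ,
        ((fun n => (stilde n : ℝ)) =O[atTop] fun n => (s n : ℝ)) ∧
        Tendsto (fun n => E * Sketch.rate (s n) (p n) (m n)) atTop (𝓝 0) ∧
        Tendsto (fun n => ∫⁻ Φ, Sketch.expectedPosterior (Sketch.prior (p n) h (μ n)) (X n) (βs n)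
            (Sketch.exceptionalSet (βs n) (E * Sketch.rate (s n) (p n) (m n)) (a n) (stilde n))
            (Matrix.of Φ) ∂(Sketch.sketchLaw (m n) n)) atTop (𝓝 0)) ∧
    Sketch.IsPolyTailDensity Sketch.horseshoeDensity 2 ∧
    ∀ ξ α : ℝ, 0 < ξ → 0 < α → Sketch.IsPolyTailDensity (Sketch.gdpDensity ξ α) (1 + α) := by
  refine ⟨?_, Sketch.isPolyTailDensity_horseshoe, fun ξ α => Sketch.isPolyTailDensity_gdp⟩
  intro p m X βs s a M μ h r u' η C' sbar hs ha hp hm hX hC' hspec hsm hmn hη hsbar hgram _ hβM hM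
    hr hh hu' hμ hμa hμL
  -- elementary consequences of the growth conditions
  have hcast : Tendsto (fun n => (p n : ℝ)) atTop atTop := tendsto_natCast_atTop_atTop.comp hp
  have hL : Tendsto (fun n => Real.log (p n)) atTop atTop := Real.tendsto_log_atTop.comp hcast
  have hmcast : Tendsto (fun n => (m n : ℝ)) atTop atTop := tendsto_natCast_atTop_atTop.comp hm
  -- The prior scale rules out an empty truth: `s = 0` would give `a = 0`, hence `μ ≤ 0`.
  have hs1 : ∀ᶠ n in atTop, 1 ≤ s n := by
    filter_upwards [hμ, hμa] with n h1 h2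
    by_contra h0
    have hs0 : s n = 0 := by omega
    have : a n = 0 := by simp [ha n, Sketch.threshold, Sketch.rate, hs0]
    rw [this, zero_mul] at h2
    linarith
  have hrate : Tendsto (fun n => Sketch.rate (s n) (p n) (m n)) atTop (𝓝 0) := by
    have := (Real.continuous_sqrt.tendsto 0).comp hsm.tendsto_div_nhds_zero
    rwa [Real.sqrt_zero] at this
  have hd : Tendsto (fun n => C' * Real.sqrt ((m n : ℝ) / n)) atTop (𝓝 0) := by
    have := ((Real.continuous_sqrt.tendsto 0).comp hmn.tendsto_div_nhds_zero).const_mul C'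
    rwa [Real.sqrt_zero, mul_zero] at this
  obtain ⟨cM, hcM⟩ := hM.bound
  obtain ⟨cμ, hcμ⟩ := hμL.bound
  obtain ⟨B, Q, hB, hQ, hprior⟩ := Sketch.exists_prior_bounds (cM := cM) (cμ := cμ) hh hr hu'
  -- choice of the constants
  obtain ⟨A₀, hA₀⟩ := exists_nat_ge ((B + 11) / (u' / 2))
  set A : ℕ := A₀ + 1 with hA
  have hA1 : 1 ≤ A := by omega
  have hAu : B + 11 ≤ u' / 2 * A := by
    rw [div_le_iff₀ (by positivity)] at hA₀
    rw [hA]; push_cast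
    linarith
  -- Truncated because the volume argument and the union bound use `√η ≤ 1`.
  set η₁ : ℝ := min η 1 with hη₁
  have hη₁0 : 0 < η₁ := lt_min hη one_pos
  -- Chosen after `A`, since the noise cost `32 A` of a support with `A s` large coordinates must be
  -- dominated. As `E ≥ 1`, `E ≤ E²` allows a linear choice of `E`.
  set E : ℝ := max 1 ((B + 53 + 32 * A) * (512 / η₁)) with hE
  have hE1 : 1 ≤ E := le_max_left _ _
  have hEB : 42 + 32 * A - η₁ / 256 * E ^ 2 / 2 ≤ -(B + 11) := by
    have h1 : (B + 53 + 32 * A) * (512 / η₁) ≤ E := le_max_right _ _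
    have h2 : E ≤ E ^ 2 := by nlinarith
    have h3 := mul_le_mul_of_nonneg_left (h1.trans h2) (div_pos hη₁0 (by norm_num : (0:ℝ) < 512)).le
    have h4 : η₁ / 512 * ((B + 53 + 32 * A) * (512 / η₁)) = B + 53 + 32 * A := by
      field_simp
    rw [h4] at h3
    linarith
  refine ⟨E, by linarith, fun n => A * s n, ?_, by simpa using hrate.const_mul E, ?_⟩
  · refine IsBigO.of_bound A (Eventually.of_forall fun n => le_of_eq ?_)
    push_cast
    rw [norm_mul, Real.norm_natCast, Real.norm_natCast]
  -- the upper bound and its limit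
  let F : ℕ → ℝ≥0∞ := fun n =>
    (1 - Sketch.sketchLaw (m n) n {Φ | Sketch.spectralNorm (Matrix.of Φ * (Matrix.of Φ)ᵀ - 1) ≤
      C' * Real.sqrt ((m n : ℝ) / n)}) +
    ENNReal.ofReal (Real.exp (-((m n : ℝ) / 4))) +
    ENNReal.ofReal (Real.exp 1 * Real.exp (-((m n : ℝ) / 4))) +
    (ENNReal.ofReal (Real.exp (Real.sqrt 2 * Real.exp (-Real.log (p n))) - 1) +
      ENNReal.ofReal ((Q + 1) * Real.exp (-Real.log (p n))))
  have hexpm : Tendsto (fun n => Real.exp (-((m n : ℝ) / 4))) atTop (𝓝 0) :=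
    Real.tendsto_exp_neg_atTop_nhds_zero.comp (hmcast.atTop_div_const (by norm_num))
  have hexpL : Tendsto (fun n => Real.exp (-Real.log (p n))) atTop (𝓝 0) :=
    Real.tendsto_exp_neg_atTop_nhds_zero.comp hL
  have hF : Tendsto F atTop (𝓝 0) := by
    have h1 := ENNReal.Tendsto.sub (tendsto_const_nhds (x := (1 : ℝ≥0∞))) hspec
      (Or.inl ENNReal.one_ne_top)
    have h2 := ENNReal.tendsto_ofReal hexpm
    have h3 := ENNReal.tendsto_ofReal (hexpm.const_mul (Real.exp 1))
    have h4 := ENNReal.tendsto_ofReal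
      (((Real.continuous_exp.tendsto _).comp (hexpL.const_mul (Real.sqrt 2))).sub_const 1)
    have h5 := ENNReal.tendsto_ofReal (hexpL.const_mul (Q + 1))
    exact (((h1.add h2).add h3).add (h4.add h5)).mono_right (le_of_eq (by simp))
  refine tendsto_of_tendsto_of_tendsto_of_le_of_le' tendsto_const_nhds hF
    (Eventually.of_forall fun _ => zero_le) ?_
  -- The constant 12 gives `3 (A + 1) s log p ≤ m / 4`, as `pow_mul_exp_le` requires; the next bound
  -- makes supports of size `(A + 1) s` admissible for the eigenvalue condition.
  have hsL := hsm.bound (show (0 : ℝ) < 1 / (12 * (A + 1)) by positivity)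
  have hsb := hsbar.bound (show (0 : ℝ) < 1 / (A + 1) by positivity)
  filter_upwards [hp.eventually_ge_atTop 1, hm.eventually_ge_atTop 1, hs1, hX, hgram, hβM, hμ, hμa,
    hcM, hcμ, hp.eventually hprior, hL.eventually_ge_atTop 0,
    hL.eventually_ge_atTop (Real.log (48 / Real.sqrt η₁)), hsL, hsb,
    hrate.eventually_le_const one_pos, hd.eventually_le_const one_pos,
    hd.eventually_le_const (show (0 : ℝ) < u' / 148 by positivity)] with n hp1 hm1 hsn hXn hgramn
    hβMn hμn hμan hcMn hcμn hpriorn hL0 hLη hsLn hsbn hrate1 hd1 hdu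
  have hp0 : (0 : ℝ) < p n := by exact_mod_cast hp1
  have hm0 : (0 : ℝ) < m n := by exact_mod_cast hm1
  have hsn' : (1 : ℝ) ≤ s n := by exact_mod_cast hsn
  set L := Real.log (p n) with hLdef
  set R := Sketch.rate (s n) (p n) (m n) with hRdef
  have hR0 : 0 ≤ R := Real.sqrt_nonneg _
  have han : a n = R / p n := by rw [ha n, Sketch.threshold]
  have ha0 : 0 < a n := by
    have h1 : 0 < (p n : ℝ) ^ (-(u' + 1) / (r - 1)) := Real.rpow_pos_of_pos hp0 _
    exact pos_of_mul_pos_left (hμn.trans_le hμan) h1.le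
  have ha1 : a n ≤ 1 := by
    rw [han]
    refine (div_le_self hR0 ?_).trans hrate1
    exact_mod_cast hp1
  have hsnorm : ‖(s n : ℝ) * L‖ = s n * L := by
    rw [Real.norm_eq_abs, abs_of_nonneg (by positivity)]
  rw [hsnorm, Real.norm_natCast] at hsLn
  have hkm : 12 * ((A + 1 : ℝ) * (s n * L)) ≤ m n := by
    calc 12 * ((A + 1 : ℝ) * (s n * L)) ≤
          12 * ((A + 1 : ℝ) * (1 / (12 * (A + 1)) * m n)) := by gcongr
      _ = m n := by field_simp
  have hLm : L ≤ (m n : ℝ) / 4 := by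
    have h1 : L ≤ s n * L := le_mul_of_one_le_left hL0 hsn'
    have h2 : s n * L ≤ (A + 1 : ℝ) * (s n * L) :=
      le_mul_of_one_le_left (by positivity) (by linarith [Nat.cast_nonneg (α := ℝ) A])
    linarith
  have hcard : (A + 1) * s n ≤ sbar n := by
    rw [Real.norm_natCast, Real.norm_natCast, one_div, inv_mul_eq_div, le_div_iff₀ (by positivity)]
      at hsbn
    have : ((A : ℝ) + 1) * s n ≤ sbar n := by linarith
    exact_mod_cast this
  have hcoef : ∀ j ∈ Sketch.activeSet (βs n), |βs n j| ≤ Real.exp (|cM| * L) := by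
    intro j hj
    have h1 := hβMn j hj
    have hM0 : 0 < M n := by linarith [abs_nonneg (βs n j)]
    rw [Real.norm_eq_abs, Real.norm_eq_abs, abs_of_nonneg hL0] at hcMn
    have h2 : M n ≤ Real.exp (|cM| * L) := by
      rw [← Real.exp_log hM0]
      refine Real.exp_le_exp.2 ((le_abs_self _).trans (hcMn.trans ?_))
      exact mul_le_mul_of_nonneg_right (le_abs_self cM) hL0
    linarith
  have hμlow : Real.exp (-(cμ * L)) ≤ μ n := by
    rw [Real.norm_eq_abs, Real.norm_eq_abs, abs_of_nonneg hL0] at hcμn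
    rw [← Real.exp_log hμn]
    exact Real.exp_le_exp.2 (by linarith [neg_abs_le (Real.log (μ n))])
  rw [hs n] at hsn
  obtain ⟨hbox, hmom⟩ := hpriorn (βs n) (a n) (μ n) hsn hμn ha0 ha1 hμan hμlow hcoef
  have := Sketch.isProbabilityMeasure_coordLaw hh hμn
  have hprob : IsProbabilityMeasure (Sketch.prior (p n) h (μ n)) := by
    rw [Sketch.prior_eq]; infer_instance
  have hmain := Sketch.lintegral_expectedPosterior_le (Sketch.prior (p n) h (μ n)) (X n) hXn (βs n)
    (m := m n) hA1 hsn hL0 hR0 ha0.le (by rw [han, mul_div_cancel₀ _ hp0.ne'])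
    (by rw [hRdef, Sketch.natCast_mul_rate_sq hm1, hs n])
    (by positivity : 0 ≤ C' * Real.sqrt ((m n : ℝ) / n)) hd1 (by linarith) hη₁0 (min_le_right _ _)
    (fun ξ hξ hξc e he => (min_le_left _ _).trans
      (hgramn ξ hξ (hξc.trans (by rw [← hs n]; exact hcard)) e he))
    hbox hQ hmom hE1
  rw [← hs n] at hmain
  refine hmain.trans (add_le_add (add_le_add (add_le_add le_rfl ?_) ?_) (add_le_add ?_ ?_)) <;>
    refine ENNReal.ofReal_le_ofReal ?_
  · calc (p n : ℝ) * Real.exp (-((m n : ℝ) / 2)) = Real.exp L * Real.exp (-((m n : ℝ) / 2)) := by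
          rw [hLdef, Real.exp_log hp0]
      _ ≤ Real.exp (-((m n : ℝ) / 4)) := by
          rw [← Real.exp_add]; exact Real.exp_le_exp.2 (by linarith)
  · refine Sketch.pow_mul_exp_le (Real.sqrt_pos.2 hη₁0) hp1 hLη ?_
    push_cast
    linarith
  · exact Sketch.one_add_pow_sub_one_le hp1
  · refine (Sketch.exp_mul_add_le (by positivity) hQ hAu hEB).trans ?_
    refine mul_le_mul_of_nonneg_left (Real.exp_le_exp.2 (neg_le_neg ?_)) (by linarith)
    exact le_mul_of_one_le_left hL0 hsn'
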